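/- Let $n\ge 1$. For $\alpha_0,\dots,\alpha_{n-2}\in\mathbb D$ and $\alpha_{n-1}\in S^1$ put $\rho_k=\sqrt{1-|\alpha_k|^2}$ and $\Xi_k=\begin{bmatrix}\bar\alpha_k&\rho_k\\ \rho_k&-\alpha_k\end{bmatrix}$ for $0\le k\le n-2$, $\Xi_{-1}=[1]$, $\Xi_{n-1}=[\bar\alpha_{n-1}]$. The associated $n\times n$ CMV matrix is the unitary matrix $\mathcal C=\mathcal L\mathcal M$ with $\mathcal L=\mathrm{diag}(\Xi_0,\Xi_2,\dots)$ and $\mathcal M=\mathrm{diag}(\Xi_{-1},\Xi_1,\Xi_3,\dots)$. Its eigenvalues $e^{i\theta_1},\dots,e^{i\theta_n}$ are distinct; let $\mu_j=|\langle e_1,\psi_j\rangle|^2$, with $\psi_j$ a unit eigenvector for $e^{i\theta_j}$, be the mass that the spectral measure of $\mathcal C$ and $e_1=[1,0,\dots,0]^T$ gives to $e^{i\theta_j}$. Write $\alpha_k=u_k+iv_k$ for $0\le k\le n-2$ and $\alpha_{n-1}=e^{i\phi}$. Let $\Omega\subset\mathbb R^{2n-1}$ be the open set of all $(\theta_1,\mu_1,\dots,\theta_{n-1},\mu_{n-1},\theta_n)$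 such that $e^{i\theta_1},\dots,e^{i\theta_n}$ are distinct and $\mu_1,\dots,\mu_n>0$, where $\mu_n=1-\mu_1-\dots-\mu_{n-1}$. Then there is a continuous map $$(\theta_1,\mu_1,\dots,\theta_{n-1},\mu_{n-1},\theta_n)\mapsto(u_0,v_0,\dots,u_{n-2},v_{n-2},\phi)$$ on $\Omega$ that sends each point to Verblunsky coordinates of a CMV matrix with these eigenvalues $e^{i\theta_j}$ and masses $\mu_j$. Every such continuous map on an open subset of $\Omega$ (that is, with any continuous choice of the angle $\phi$) is differentiable, and its Jacobian is $$\det\left[\frac{\partial(u_0,v_0,\dots,u_{n-2},v_{n-2},\phi)}{\partial(\theta_1,\mu_1,\dots,\theta_{n-1},\mu_{n-1},\theta_n)}\right]=-2^{1-n}\,\frac{\rho_0^2\cdots\rho_{n-2}^2}{\mu_1\cdots\mu_n}.$$ -/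

import Mathlib

noncomputable section

namespace CMV

/-- `ρ = √(1 - |α|²)`. -/
def rho (a : ℂ) : ℝ := Real.sqrt (1 - ‖a‖ ^ 2)

/-- The block-diagonal matrix `L = diag(Ξ₀, Ξ₂, Ξ₄, …)` of size `n`, where
`Ξ_k = [conj α_k, ρ_k; ρ_k, -α_k]` occupies rows and columns `k, k+1` (counted from `0`), and
`Ξ_{n-1} = [conj α_{n-1}]` is `1 × 1`. -/
def L {n : ℕ} (α : Fin n → ℂ) : Matrix (Fin n) (Fin n) ℂ :=
  Matrix.of fun i j =>
    if i = j then
      if Even i.val then star (α i)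
      else -α ⟨i.val - 1, (Nat.sub_le _ _).trans_lt i.isLt⟩
    else if j.val = i.val + 1 ∧ Even i.val then (rho (α i) : ℂ)
    else if i.val = j.val + 1 ∧ Even j.val then (rho (α j) : ℂ)
    else 0

/-- The block-diagonal matrix `M = diag(Ξ₋₁, Ξ₁, Ξ₃, …)` of size `n`, with `Ξ₋₁ = [1]`. -/
def M {n : ℕ} (α : Fin n → ℂ) : Matrix (Fin n) (Fin n) ℂ :=
  Matrix.of fun i j =>
    if i = j then
      if i.val = 0 then 1
      else if Odd i.val then star (α i)
      else -α ⟨i.val - 1, (Nat.sub_le _ _).trans_lt i.isLt⟩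
    else if j.val = i.val + 1 ∧ Odd i.val then (rho (α i) : ℂ)
    else if i.val = j.val + 1 ∧ Odd j.val then (rho (α j) : ℂ)
    else 0

/-- The CMV matrix `C = L M` with Verblunsky coefficients `α₀, …, α_{n-1}`. -/
def cmv {n : ℕ} (α : Fin n → ℂ) : Matrix (Fin n) (Fin n) ℂ := L α * M α

/-- `C` has eigenvalues `e^{iθ_j}`, and the spectral measure of `C` and the first basis vector
gives them the masses `μ_j`: the columns of a unitary matrix `V` are orthonormal eigenvectors `ψ_j`
with eigenvalues `e^{iθ_j}`, and `μ_j = |⟨e₁, ψ_j⟩|²`. -/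
def HasSpectralData {n : ℕ} [NeZero n] (C : Matrix (Fin n) (Fin n) ℂ) (θ μ : Fin n → ℝ) : Prop :=
  ∃ V ∈ Matrix.unitaryGroup (Fin n) ℂ,
    C * V = V * Matrix.diagonal (fun j => Complex.exp (θ j * Complex.I)) ∧
    ∀ j, μ j = ‖V 0 j‖ ^ 2

/-- The space `ℝ^{2n-1}` with `n = m + 1`. A point is read either as
`(θ₁, μ₁, …, θ_{n-1}, μ_{n-1}, θ_n)` or as `(u₀, v₀, …, u_{n-2}, v_{n-2}, φ)`:
the pairs are the values of the first component, in the same order. -/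
abbrev Coord (m : ℕ) : Type := (Fin m → ℝ × ℝ) × ℝ

/-- The angles `θ₁, …, θ_n`. -/
def theta {m : ℕ} (x : Coord m) : Fin (m + 1) → ℝ :=
  Fin.snoc (fun k => (x.1 k).1) x.2

/-- The masses `μ₁, …, μ_n`, where `μ_n = 1 - μ₁ - ⋯ - μ_{n-1}`. -/
def mass {m : ℕ} (x : Coord m) : Fin (m + 1) → ℝ :=
  Fin.snoc (fun k => (x.1 k).2) (1 - ∑ k, (x.1 k).2)

/-- The parameters of probability measures on the circle supported at exactly `n = m + 1` points. -/
def specDomain (m : ℕ) : Set (Coord m) :=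
  {x | (Function.Injective fun j => Complex.exp (theta x j * Complex.I)) ∧ ∀ j, 0 < mass x j}

/-- The Verblunsky coefficients `α_k = u_k + i v_k` for `k ≤ n - 2`, and `α_{n-1} = e^{iφ}`. -/
def verblunsky {m : ℕ} (y : Coord m) : Fin (m + 1) → ℂ :=
  Fin.snoc (fun k => (⟨(y.1 k).1, (y.1 k).2⟩ : ℂ)) (Complex.exp (y.2 * Complex.I))

/-- `y = (u₀, v₀, …, φ)` are Verblunsky coordinates of a CMV matrix whose eigenvalue angles and
masses are given by `x = (θ₁, μ₁, …, θ_n)`. -/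
def Corresponds {m : ℕ} (x y : Coord m) : Prop :=
  (∀ k : Fin m, ‖verblunsky y k.castSucc‖ < 1) ∧
    HasSpectralData (cmv (verblunsky y)) (theta x) (mass x)

/-- `F` is the change of variables `(θ, μ) ↦ (u, v, φ)` on `U`. As `φ` is an angle, `F` is
determined up to the choice of a continuous branch of `φ`. -/
def IsChangeOfVariables {m : ℕ} (U : Set (Coord m)) (F : Coord m → Coord m) : Prop :=
  ContinuousOn F U ∧ ∀ x ∈ U, Corresponds x (F x)

end CMV

end

noncomputable section

namespace CMV

open Matrix

/-! With n = m + 1, both coordinate systems are compared with the moments c_k = ⟨e₀, C^k e₀⟩ = ∑ μ_j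
e^{ikθ_j}. Take c_1, …, c_n and the conjugates of c_1, …, c_{n-1}. By the chain rule
(`specJacobian_eq_mul`) their Jacobian in (θ, μ) is their Jacobian in (u, v, φ) times the one
sought.

In Verblunsky coordinates, c_{k+1} = conj(α_k) ∏_{l<k} ρ_l² plus a function of α_0, …, α_{k-1}
(`moment_succ_sub`, `krylov_diag`). The Jacobian is therefore block triangular, and its determinant
can be read off (`det_momentJacobian`). In spectral coordinates it is a confluent Vandermonde matrix
with scaled columns, with determinant i^n ∏μ_j · (-1)^m |Δ|⁴ ∏ e^{iθ_j}, where Δ is the Vandermonde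
determinant of the eigenvalues (`det_confluent`, `det_specJacobian`).

Two identities simplify the quotient: ∏_k ∏_{l<k} ρ_l² = |Δ|² ∏μ_j (`prod_krylov_diag`) removes Δ,
and ∏ e^{iθ_j} = det C = (-1)^m conj(α_{n-1}) (`det_cmv`) removes the phase.

The triangular form also determines α_k recursively from the moments, which gives differentiability
(`differentiableAt_verblunsky`). Existence of a CMV matrix with prescribed data comes from the Szegő
recursion, which orthonormalizes 1, z, z⁻¹, z², … (`exists_hasSpectralData`). The determinant
identity fixes e^{iφ}, so φ = mπ - ∑θ_j is a global continuous choice. -/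

/-! ### Rows of the two block-diagonal factors -/

/-- The factor `L` for even `r` and `M` for odd `r`: the one that contains the block `Ξ_r`. -/
def factor {n : ℕ} (α : Fin n → ℂ) (r : ℕ) : Matrix (Fin n) (Fin n) ℂ :=
  if Even r then L α else M α

theorem factor_apply {n : ℕ} (α : Fin n → ℂ) (r : ℕ) (i j : Fin n) :
    factor α r i j =
      if i = j then
        if Even (i.val + r) then star (α i)
        else if i.val = 0 then 1
        else -α ⟨i.val - 1, (Nat.sub_le _ _).trans_lt i.isLt⟩
      else if j.val = i.val + 1 ∧ Even (i.val + r) then (rho (α i) : ℂ)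
      else if i.val = j.val + 1 ∧ Even (j.val + r) then (rho (α j) : ℂ)
      else 0 := by
  by_cases hr : Even r
  · have h0 : ∀ k : ℕ, Even (k + r) ↔ Even k := fun k => by simp [Nat.even_add, hr]
    simp only [factor, hr, if_true, h0, L, Matrix.of_apply]
    by_cases hi : i.val = 0
    · simp [hi]
    · simp [hi]
  · have h0 : ∀ k : ℕ, Even (k + r) ↔ Odd k := fun k => by
      rw [Nat.even_add, ← Nat.not_even_iff_odd]; tauto
    simp only [factor, hr, if_false, h0, M, Matrix.of_apply]
    by_cases hi : i.val = 0
    · simp [hi]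
    · simp [hi]

theorem factor_transpose {n : ℕ} (α : Fin n → ℂ) (r : ℕ) : (factor α r)ᵀ = factor α r := by
  ext i j
  rw [Matrix.transpose_apply, factor_apply, factor_apply]
  by_cases h : i = j
  · subst h; simp
  · have h' : j ≠ i := fun e => h e.symm
    simp only [h, h', if_false]
    split_ifs <;> first | rfl | omega

theorem factor_mulVec_top {n : ℕ} (α : Fin n → ℂ) (r : ℕ) (v : Fin n → ℂ) (i j : Fin n)
    (hij : j.val = i.val + 1) (h : Even (i.val + r)) :
    (factor α r *ᵥ v) i = star (α i) * v i + rho (α i) * v j := by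
  have hne : i ≠ j := fun e => by rw [e] at hij; omega
  have hodd : ¬ Even (i.val + 1 + r) := by
    rw [show i.val + 1 + r = i.val + r + 1 by ring, Nat.even_add_one]; simpa using h
  simp only [Matrix.mulVec, dotProduct]
  rw [Fintype.sum_eq_add i j hne]
  · rw [factor_apply, factor_apply]; simp [h, hne, hij]
  · rintro k ⟨hki, hkj⟩
    have h1 : i ≠ k := fun e => hki e.symm
    have h2 : k.val ≠ i.val + 1 := fun e => hkj (Fin.ext (by omega))
    rw [factor_apply]
    have h3 : ¬ (i.val = k.val + 1 ∧ Even (k.val + r)) := by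
      rintro ⟨e, f⟩
      rw [e, show k.val + 1 + r = k.val + r + 1 by ring, Nat.even_add_one] at h
      exact h f
    rw [if_neg h1, if_neg (fun e => h2 e.1), if_neg h3, zero_mul]

theorem factor_mulVec_last {n : ℕ} (α : Fin n → ℂ) (r : ℕ) (v : Fin n → ℂ) (i : Fin n)
    (hi : i.val + 1 = n) (h : Even (i.val + r)) :
    (factor α r *ᵥ v) i = star (α i) * v i := by
  simp only [Matrix.mulVec, dotProduct]
  rw [Fintype.sum_eq_single i]
  · rw [factor_apply]; simp [h]
  · intro k hki
    have h1 : i ≠ k := fun e => hki e.symm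
    rw [factor_apply]
    have h3 : ¬ (i.val = k.val + 1 ∧ Even (k.val + r)) := by
      rintro ⟨e, f⟩
      rw [e, show k.val + 1 + r = k.val + r + 1 by ring, Nat.even_add_one] at h
      exact h f
    rw [if_neg h1, if_neg (fun e => by omega), if_neg h3, zero_mul]

theorem factor_mulVec_bot {n : ℕ} (α : Fin n → ℂ) (r : ℕ) (v : Fin n → ℂ) (i j : Fin n)
    (hij : j.val = i.val + 1) (h : Even (i.val + r)) :
    (factor α r *ᵥ v) j = rho (α i) * v i - α i * v j := by
  have hne : i ≠ j := fun e => by rw [e] at hij; omega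
  have hodd : ¬ Even (j.val + r) := by
    rw [hij, show i.val + 1 + r = i.val + r + 1 by ring, Nat.even_add_one]; simpa using h
  have hi' : (⟨j.val - 1, (Nat.sub_le _ _).trans_lt j.isLt⟩ : Fin n) = i :=
    Fin.ext (by simp [hij])
  simp only [Matrix.mulVec, dotProduct]
  rw [Fintype.sum_eq_add i j hne]
  · rw [factor_apply, factor_apply, if_neg hne.symm, if_neg (fun e => by omega), if_pos ⟨hij, h⟩,
      if_pos rfl, if_neg hodd, if_neg (by omega), hi']
    ring
  · rintro k ⟨hki, hkj⟩
    have h1 : j ≠ k := fun e => hkj e.symm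
    have h2 : j.val ≠ k.val + 1 := fun e => hki (Fin.ext (by omega))
    rw [factor_apply, if_neg h1, if_neg (fun e => hodd e.2), if_neg (fun e => h2 e.1), zero_mul]

theorem factor_mulVec_zero {n : ℕ} (α : Fin n → ℂ) (r : ℕ) (v : Fin n → ℂ) (i : Fin n)
    (hi : i.val = 0) (h : ¬ Even r) : (factor α r *ᵥ v) i = v i := by
  simp only [Matrix.mulVec, dotProduct]
  rw [Fintype.sum_eq_single i]
  · rw [factor_apply]; simp [h, hi]
  · intro k hki
    have h1 : i ≠ k := fun e => hki e.symm
    rw [factor_apply, if_neg h1, if_neg (fun e => h (by simpa [hi] using e.2)),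
      if_neg (fun e => by omega), zero_mul]

/-- Each row of a factor falls under one of the four preceding descriptions. -/
theorem factor_row_cases {n : ℕ} (r : ℕ) (i : Fin n) :
    (Even (i.val + r) ∧ ∃ j : Fin n, j.val = i.val + 1) ∨ (Even (i.val + r) ∧ i.val + 1 = n) ∨
      (∃ j : Fin n, i.val = j.val + 1 ∧ Even (j.val + r)) ∨ (i.val = 0 ∧ ¬ Even r) := by
  by_cases h : Even (i.val + r)
  · by_cases hn : i.val + 1 = n
    · exact Or.inr (Or.inl ⟨h, hn⟩)
    · exact Or.inl ⟨h, ⟨i.val + 1, by omega⟩, rfl⟩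
  · by_cases hi : i.val = 0
    · exact Or.inr (Or.inr (Or.inr ⟨hi, by simpa [hi] using h⟩))
    · refine Or.inr (Or.inr (Or.inl ⟨⟨i.val - 1, by omega⟩, by simp; omega, ?_⟩))
      by_contra h'
      apply h
      rw [← Nat.even_add_one] at h'
      convert h' using 1
      simp only
      omega

/-! ### Krylov vectors and moments -/

/-- The vectors `e₀, L e₀, M L e₀, L M L e₀, …`. -/
def krylov {n : ℕ} [NeZero n] (α : Fin n → ℂ) : ℕ → Fin n → ℂ
  | 0 => Pi.single 0 1
  | r + 1 => factor α r *ᵥ krylov α r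

theorem krylov_zero {n : ℕ} [NeZero n] (α : Fin n → ℂ) : krylov α 0 = Pi.single 0 1 := rfl

theorem krylov_succ {n : ℕ} [NeZero n] (α : Fin n → ℂ) (r : ℕ) :
    krylov α (r + 1) = factor α r *ᵥ krylov α r := rfl

/-- The blocks of a factor couple only neighbouring indices, so each application enlarges the
support by at most one index. -/
theorem krylov_eq_zero {n : ℕ} [NeZero n] (α : Fin n → ℂ) (r : ℕ) (i : Fin n) (h : r < i.val) :
    krylov α r i = 0 := by
  induction r generalizing i with
  | zero =>
    rw [krylov_zero, Pi.single_apply, if_neg]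
    rintro rfl
    simp at h
  | succ r ih =>
    rw [krylov_succ]
    rcases factor_row_cases r i with ⟨he, j, hj⟩ | ⟨he, hn⟩ | ⟨j, hj, he⟩ | ⟨h0, -⟩
    · rw [factor_mulVec_top α r _ i j hj he, ih i (by omega), ih j (by omega)]; simp
    · rw [factor_mulVec_last α r _ i hn he, ih i (by omega)]; simp
    · rw [factor_mulVec_bot α r _ j i hj he, ih i (by omega), ih j (by omega)]; simp
    · omega

theorem krylov_succ_diag {n : ℕ} [NeZero n] (α : Fin n → ℂ) (i j : Fin n) (h : j.val = i.val + 1) :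
    krylov α j j = rho (α i) * krylov α i i := by
  have e : krylov α j.val j = (factor α i.val *ᵥ krylov α i) j := by rw [h]; rfl
  rw [e, factor_mulVec_bot α i.val _ i j h ⟨_, rfl⟩, krylov_eq_zero α i j (by omega)]
  ring

theorem krylov_diag {n : ℕ} [NeZero n] (α : Fin n → ℂ) (i : Fin n) :
    krylov α i i = ((∏ l : Fin n with l < i, rho (α l) : ℝ) : ℂ) := by
  obtain ⟨k, hk⟩ := i
  induction k with
  | zero =>
    have : (⟨0, hk⟩ : Fin n) = 0 := Fin.ext (by simp)
    rw [this]
    have h0 : (Finset.univ.filter fun l : Fin n => l < 0) = ∅ :=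
      Finset.filter_eq_empty_iff.2 fun l _ => Fin.not_lt_zero l
    rw [h0]
    simp [krylov_zero]
  | succ k ih =>
    rw [krylov_succ_diag α ⟨k, by omega⟩ ⟨k + 1, hk⟩ rfl, ih (by omega)]
    have : (Finset.univ.filter fun l : Fin n => l < ⟨k + 1, hk⟩) =
        insert ⟨k, by omega⟩ (Finset.univ.filter fun l : Fin n => l < ⟨k, by omega⟩) := by
      ext l; simp only [Finset.mem_filter, Finset.mem_univ, true_and, Finset.mem_insert,
        Fin.lt_def, Fin.ext_iff]; omega
    rw [this, Finset.prod_insert (by simp)]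
    push_cast; ring

/-- A coefficient α_l with l ≥ r enters one of the first r steps only through entries where the
current vector still vanishes. -/
theorem krylov_congr {n : ℕ} [NeZero n] (α β : Fin n → ℂ) (r : ℕ)
    (h : ∀ l : Fin n, l.val < r → α l = β l) : krylov α r = krylov β r := by
  induction r with
  | zero => rfl
  | succ r ih =>
    have ih := ih fun l hl => h l (by omega)
    ext i
    rw [krylov_succ, krylov_succ, ← ih]
    rcases factor_row_cases r i with ⟨he, j, hj⟩ | ⟨he, hn⟩ | ⟨j, hj, he⟩ | ⟨h0, h1⟩
    · rw [factor_mulVec_top α r _ i j hj he, factor_mulVec_top β r _ i j hj he]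
      by_cases hi : i.val < r + 1
      · rw [h i hi]
      · rw [krylov_eq_zero α r i (by omega), krylov_eq_zero α r j (by omega)]; simp
    · rw [factor_mulVec_last α r _ i hn he, factor_mulVec_last β r _ i hn he]
      by_cases hi : i.val < r + 1
      · rw [h i hi]
      · rw [krylov_eq_zero α r i (by omega)]; simp
    · rw [factor_mulVec_bot α r _ j i hj he, factor_mulVec_bot β r _ j i hj he]
      by_cases hi : j.val < r + 1
      · rw [h j hi]
      · rw [krylov_eq_zero α r i (by omega), krylov_eq_zero α r j (by omega)]; simp
    · rw [factor_mulVec_zero α r _ i h0 h1, factor_mulVec_zero β r _ i h0 h1]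

/-- The moment `⟨e₀, C^r e₀⟩`. -/
def moment {n : ℕ} [NeZero n] (α : Fin n → ℂ) (r : ℕ) : ℂ := (cmv α ^ r) 0 0

theorem M_mulVec_single {n : ℕ} [NeZero n] (α : Fin n → ℂ) :
    M α *ᵥ Pi.single 0 1 = Pi.single 0 1 := by
  have hM : M α = factor α 1 := by simp [factor]
  rw [hM]
  ext i
  rcases factor_row_cases 1 i with ⟨he, j, hj⟩ | ⟨he, hn⟩ | ⟨j, hj, he⟩ | ⟨h0, h1⟩
  · have hi : i ≠ 0 := by rintro rfl; simp at he
    have hj : j ≠ 0 := by rintro rfl; simp at hj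
    rw [factor_mulVec_top α 1 _ i j (by assumption) he]; simp [hi, hj]
  · have hi : i ≠ 0 := by rintro rfl; simp at he
    rw [factor_mulVec_last α 1 _ i hn he]; simp [hi]
  · have hj' : j ≠ 0 := by rintro rfl; simp at he
    have hi : i ≠ 0 := by rintro rfl; simp at hj
    rw [factor_mulVec_bot α 1 _ j i hj he]; simp [hi, hj']
  · rw [factor_mulVec_zero α 1 _ i h0 h1]

theorem L_transpose {n : ℕ} (α : Fin n → ℂ) : (L α)ᵀ = L α := by
  simpa [factor] using factor_transpose α 0

theorem M_transpose {n : ℕ} (α : Fin n → ℂ) : (M α)ᵀ = M α := by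
  simpa [factor] using factor_transpose α 1

/-- Since `L` and `M` are symmetric, `M * L` is the transpose of the CMV matrix. -/
theorem krylov_even {n : ℕ} [NeZero n] (α : Fin n → ℂ) (t : ℕ) :
    krylov α (2 * t) = ((cmv α)ᵀ ^ t) *ᵥ Pi.single 0 1 := by
  induction t with
  | zero => rw [mul_zero, krylov_zero, pow_zero, Matrix.one_mulVec]
  | succ t ih =>
    rw [show 2 * (t + 1) = 2 * t + 1 + 1 by ring, krylov_succ, krylov_succ, ih, pow_succ']
    have h1 : factor α (2 * t) = L α := by simp [factor]
    have h2 : factor α (2 * t + 1) = M α := by simp [factor]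
    rw [h1, h2, Matrix.mulVec_mulVec, Matrix.mulVec_mulVec, cmv, Matrix.transpose_mul,
      L_transpose, M_transpose, Matrix.mul_assoc]

/-- Regroup L (M L)^t as (L M)^(t+1) with a missing last `M`, which may be supplied because `M`
fixes e₀. -/
theorem krylov_odd {n : ℕ} [NeZero n] (α : Fin n → ℂ) (t : ℕ) :
    krylov α (2 * t + 1) = (cmv α ^ (t + 1)) *ᵥ Pi.single 0 1 := by
  have h1 : factor α (2 * t) = L α := by simp [factor]
  rw [krylov_succ, krylov_even, h1]
  have h : ∀ t : ℕ, L α * (cmv α)ᵀ ^ t * M α = cmv α ^ (t + 1) := by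
    intro t
    induction t with
    | zero => simp [cmv]
    | succ t ih =>
      rw [pow_succ (cmv α) (t + 1), ← ih, pow_succ, cmv, Matrix.transpose_mul, L_transpose,
        M_transpose]
      simp only [Matrix.mul_assoc]
  rw [← h, ← Matrix.mulVec_mulVec, M_mulVec_single, ← Matrix.mulVec_mulVec]

theorem moment_succ {n : ℕ} [NeZero n] (α : Fin n → ℂ) (r : ℕ) :
    moment α (r + 1) = krylov α r ⬝ᵥ krylov α (r + 1) := by
  -- The pairing is bilinear, without conjugation, so the transposed power moves across it
  -- unchanged.
  have key : ∀ s t : ℕ, ((cmv α)ᵀ ^ s *ᵥ Pi.single 0 1) ⬝ᵥ (cmv α ^ t *ᵥ Pi.single 0 1) =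
      moment α (s + t) := by
    intro s t
    rw [← Matrix.transpose_pow, Matrix.mulVec_transpose, ← Matrix.dotProduct_mulVec,
      Matrix.mulVec_mulVec, ← pow_add, moment]
    simp
  obtain ⟨t, rfl | rfl⟩ : ∃ t, r = 2 * t ∨ r = 2 * t + 1 := ⟨r / 2, by omega⟩
  · rw [krylov_odd, krylov_even, key]; congr 1; ring
  · rw [krylov_odd, show 2 * t + 1 + 1 = 2 * (t + 1) by ring, krylov_even, dotProduct_comm, key]
    congr 1; ring

/-- The r-th Krylov vector w is common to both, so the difference is w · (F_α - F_β) w, with F the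
r-th factor. Rows below index r involve equal coefficients, and w vanishes above r, so only row r
contributes. This is the source of all triangularity below. -/
theorem moment_succ_sub {n : ℕ} [NeZero n] (α β : Fin n → ℂ) (r : Fin n)
    (h : ∀ l : Fin n, l < r → α l = β l) :
    moment α (r + 1) - moment β (r + 1) = star (α r - β r) * krylov α r r ^ 2 := by
  have hw : krylov α r = krylov β r := krylov_congr α β r fun l hl => h l hl
  rw [moment_succ, moment_succ, krylov_succ, krylov_succ, ← hw, ← dotProduct_sub, dotProduct]
  rw [Fintype.sum_eq_single r]
  · rcases factor_row_cases r.val r with ⟨he, j, hj⟩ | ⟨he, hn⟩ | ⟨j, hj, he⟩ | ⟨h0, h1⟩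
    · rw [Pi.sub_apply, factor_mulVec_top α r _ r j hj he, factor_mulVec_top β r _ r j hj he,
        krylov_eq_zero α r j (by omega), star_sub]
      ring
    · rw [Pi.sub_apply, factor_mulVec_last α r _ r hn he, factor_mulVec_last β r _ r hn he,
        star_sub]
      ring
    -- Index r is always the top row of its block in the r-th factor, as r + r is even.
    · exfalso
      rw [hj, show j.val + (j.val + 1) = 2 * j.val + 1 by ring] at he
      simp at he
    · exact absurd (by simp [h0]) h1
  · intro i hi
    by_cases hir : r.val < i.val
    · rw [krylov_eq_zero α r i hir, zero_mul]
    · have hir : i < r := lt_of_le_of_ne (not_lt.1 hir) hi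
      have hz : (factor α r *ᵥ krylov α r - factor β r *ᵥ krylov α r) i = 0 := by
        rw [Pi.sub_apply, sub_eq_zero]
        rcases factor_row_cases r.val i with ⟨he, j, hj⟩ | ⟨he, hn⟩ | ⟨j, hj, he⟩ | ⟨h0, h1⟩
        · rw [factor_mulVec_top α r _ i j hj he, factor_mulVec_top β r _ i j hj he, h i hir]
        · rw [factor_mulVec_last α r _ i hn he, factor_mulVec_last β r _ i hn he, h i hir]
        · have hjr : j < r := lt_trans (Fin.lt_def.2 (by omega)) hir
          rw [factor_mulVec_bot α r _ j i hj he, factor_mulVec_bot β r _ j i hj he, h j hjr]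
        · rw [factor_mulVec_zero α r _ i h0 h1, factor_mulVec_zero β r _ i h0 h1]
      rw [hz, mul_zero]

/-! ### Differentiability in the Verblunsky coefficients -/

theorem rho_pos {a : ℂ} (h : ‖a‖ < 1) : 0 < rho a := by
  rw [rho, Real.sqrt_pos]
  nlinarith [norm_nonneg a]

theorem rho_sq {a : ℂ} (h : ‖a‖ ≤ 1) : rho a ^ 2 = 1 - ‖a‖ ^ 2 := by
  rw [rho, Real.sq_sqrt]
  nlinarith [norm_nonneg a]

theorem krylov_diag_ne_zero {n : ℕ} [NeZero n] (α : Fin n → ℂ) (i : Fin n)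
    (h : ∀ l < i, ‖α l‖ < 1) : krylov α i i ≠ 0 := by
  rw [krylov_diag, Complex.ofReal_ne_zero]
  exact Finset.prod_ne_zero_iff.2 fun l hl => (rho_pos (h l (by simpa using hl))).ne'

theorem differentiableAt_rho {E : Type*} [NormedAddCommGroup E] [NormedSpace ℝ E] {f : E → ℂ}
    {x : E} (hf : DifferentiableAt ℝ f x) (h : ‖f x‖ < 1) :
    DifferentiableAt ℝ (fun y => (rho (f y) : ℂ)) x := by
  have h1 : DifferentiableAt ℝ (fun y => rho (f y)) x :=
    ((hf.norm_sq ℝ).const_sub 1).sqrt (by nlinarith [norm_nonneg (f x)])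
  exact Complex.ofRealCLM.differentiableAt.comp x h1

theorem differentiableAt_krylov {n : ℕ} [NeZero n] {E : Type*} [NormedAddCommGroup E]
    [NormedSpace ℝ E] {γ : E → Fin n → ℂ} {x : E} (r : ℕ)
    (hd : ∀ l : Fin n, l.val < r → DifferentiableAt ℝ (fun y => γ y l) x)
    (hn : ∀ l : Fin n, l.val < r → ‖γ x l‖ < 1) (i : Fin n) :
    DifferentiableAt ℝ (fun y => krylov (γ y) r i) x := by
  induction r generalizing i with
  | zero => simp only [krylov_zero]; fun_prop
  | succ r ih =>
    have ih := fun i => ih (fun l hl => hd l (by omega)) (fun l hl => hn l (by omega)) i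
    by_cases hi : r + 1 < i.val
    · simp only [krylov_eq_zero _ _ i hi]; fun_prop
    simp only [krylov_succ]
    rcases factor_row_cases r i with ⟨he, j, hj⟩ | ⟨he, hn'⟩ | ⟨j, hj, he⟩ | ⟨h0, h1⟩
    -- As i ≤ r + 1 and i + r is even, i = r + 1 is impossible; hence only coefficients of index at
    -- most r occur.
    · have hir : i.val < r + 1 := by
        rcases Nat.lt_or_ge i.val (r + 1) with h | h
        · exact h
        · have : i.val + r = 2 * r + 1 := by omega
          rw [this] at he
          simp at he
      simp only [factor_mulVec_top _ r _ i j hj he]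
      exact ((hd i hir).star.mul (ih i)).add ((differentiableAt_rho (hd i hir) (hn i hir)).mul (ih j))
    · have hir : i.val < r + 1 := by
        rcases Nat.lt_or_ge i.val (r + 1) with h | h
        · exact h
        · have : i.val + r = 2 * r + 1 := by omega
          rw [this] at he
          simp at he
      simp only [factor_mulVec_last _ r _ i hn' he]
      exact (hd i hir).star.mul (ih i)
    · have hjr : j.val < r + 1 := by omega
      simp only [factor_mulVec_bot _ r _ j i hj he]
      exact ((differentiableAt_rho (hd j hjr) (hn j hjr)).mul (ih j)).sub ((hd j hjr).mul (ih i))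
    · simp only [factor_mulVec_zero _ r _ i h0 h1]
      exact ih i

/-- The coefficients below `r`, continued by `0`. -/
def truncate {n : ℕ} (α : Fin n → ℂ) (r : Fin n) : Fin n → ℂ := fun l => if l < r then α l else 0

/-- Isolates the newest coefficient. The rest uses only earlier ones, and the filler 0 stays inside
the disc, where `rho` is smooth. At α_{n-1}, on the circle, `rho` would not be. -/
theorem moment_succ_eq_truncate {n : ℕ} [NeZero n] (α : Fin n → ℂ) (r : Fin n) :
    moment α (r + 1) = star (α r) * krylov α r r ^ 2 + moment (truncate α r) (r + 1) := by
  have h := moment_succ_sub α (truncate α r) r fun l hl => by simp [truncate, hl]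
  rw [← sub_eq_iff_eq_add, h]
  simp [truncate]

theorem differentiableAt_moment_truncate {n : ℕ} [NeZero n] {E : Type*} [NormedAddCommGroup E]
    [NormedSpace ℝ E] {γ : E → Fin n → ℂ} {x : E} (r : Fin n)
    (hd : ∀ l < r, DifferentiableAt ℝ (fun y => γ y l) x) (hn : ∀ l < r, ‖γ x l‖ < 1) :
    DifferentiableAt ℝ (fun y => moment (truncate (γ y) r) (r + 1)) x := by
  have hd' : ∀ l : Fin n, DifferentiableAt ℝ (fun y => truncate (γ y) r l) x := by
    intro l
    by_cases h : l < r
    · simpa [truncate, h] using hd l h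
    · simp [truncate, h]
  have hn' : ∀ l : Fin n, ‖truncate (γ x) r l‖ < 1 := by
    intro l
    by_cases h : l < r
    · simpa [truncate, h] using hn l h
    · simp [truncate, h]
  simp only [moment_succ, dotProduct]
  refine DifferentiableAt.fun_sum fun i _ => ?_
  exact (differentiableAt_krylov r.val (fun l _ => hd' l) (fun l _ => hn' l) i).mul
    (differentiableAt_krylov (r.val + 1) (fun l _ => hd' l) (fun l _ => hn' l) i)

theorem differentiableAt_moment {n : ℕ} [NeZero n] {E : Type*} [NormedAddCommGroup E]
    [NormedSpace ℝ E] {γ : E → Fin n → ℂ} {x : E} (r : Fin n)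
    (hd : ∀ l ≤ r, DifferentiableAt ℝ (fun y => γ y l) x) (hn : ∀ l < r, ‖γ x l‖ < 1) :
    DifferentiableAt ℝ (fun y => moment (γ y) (r + 1)) x := by
  rw [funext fun y => moment_succ_eq_truncate (γ y) r]
  exact ((hd r le_rfl).star.mul ((differentiableAt_krylov r.val (fun l hl => hd l (le_of_lt hl))
    (fun l hl => hn l hl) r).pow 2)).add
    (differentiableAt_moment_truncate r (fun l hl => hd l hl.le) hn)

/-! ### Determinant of a CMV matrix -/

theorem L_submatrix {n : ℕ} (α : Fin (2 + n) → ℂ) :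
    (L α).submatrix finSumFinEquiv finSumFinEquiv =
      Matrix.fromBlocks !![star (α (Fin.castAdd n 0)), (rho (α (Fin.castAdd n 0)) : ℂ);
        (rho (α (Fin.castAdd n 0)) : ℂ), -α (Fin.castAdd n 0)] 0 0
        (L fun i => α (Fin.natAdd 2 i)) := by
  ext i j
  rcases i with i | i <;> rcases j with j | j
  · fin_cases i <;> fin_cases j <;> (simp [L, Fin.ext_iff]; try rfl)
  · have h1 : ¬ (2 + j.val = i.val + 1 ∧ Even i.val) := by
      rintro ⟨h, h'⟩; have := i.isLt
      have h2 : i.val = 1 := by omega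
      rw [h2] at h'; simp at h'
    have h2 : ¬ (i.val = 2 + j.val + 1 ∧ Even (2 + j.val)) := by omega
    have h3 : ¬ i.val = 2 + j.val := by omega
    simp [L, Fin.ext_iff, h1, h2, h3]
  · have h1 : ¬ (2 + i.val = j.val + 1 ∧ Even j.val) := by
      rintro ⟨h, h'⟩; have := j.isLt
      have h2 : j.val = 1 := by omega
      rw [h2] at h'; simp at h'
    have h2 : ¬ (j.val = 2 + i.val + 1 ∧ Even (2 + i.val)) := by omega
    have h3 : ¬ 2 + i.val = j.val := by omega
    simp [L, Fin.ext_iff, h1, h2, h3]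
  · have he : ∀ k : ℕ, Even (2 + k) ↔ Even k := fun k => by simp [Nat.even_add]
    simp only [L, submatrix_apply, of_apply, finSumFinEquiv_apply_right, fromBlocks_apply₂₂,
      Fin.natAdd_inj, Fin.val_natAdd, he]
    by_cases hij : i = j
    · simp only [hij, if_true]
      by_cases hj : Even j.val
      · simp [hj]
      · simp only [hj, if_false, neg_inj]
        congr 1
        have : j.val ≠ 0 := fun h => by rw [h] at hj; simp at hj
        exact Fin.ext (by simp; omega)
    · simp only [hij, if_false]
      have e1 : 2 + j.val = 2 + i.val + 1 ↔ j.val = i.val + 1 := by omega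
      have e2 : 2 + i.val = 2 + j.val + 1 ↔ i.val = j.val + 1 := by omega
      simp only [e1, e2]

/-- The block Ξ_0 that is split off has determinant -|α_0|² - ρ_0² = -1. -/
theorem det_L_two_add {n : ℕ} (α : Fin (2 + n) → ℂ) (h : ‖α (Fin.castAdd n 0)‖ < 1) :
    (L α).det = -(L fun i => α (Fin.natAdd 2 i)).det := by
  rw [← Matrix.det_submatrix_equiv_self finSumFinEquiv, L_submatrix, det_fromBlocks_zero₂₁,
    det_fin_two_of]
  have h2 : ((rho (α (Fin.castAdd n 0)) : ℝ) : ℂ) ^ 2 = 1 - (‖α (Fin.castAdd n 0)‖ : ℂ) ^ 2 := by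
    exact_mod_cast rho_sq h.le
  have h1 := Complex.conj_mul' (α (Fin.castAdd n 0))
  simp only [Complex.star_def]
  linear_combination (-(L fun i => α (Fin.natAdd 2 i)).det) * (h1 + h2)

theorem det_L_even (k : ℕ) : ∀ (n : ℕ), n = 2 * k → ∀ (α : Fin n → ℂ),
    (∀ l : Fin n, l.val + 1 < n → ‖α l‖ < 1) → (L α).det = (-1) ^ k := by
  induction k with
  | zero => rintro n rfl α -; simp
  | succ k ih =>
    intro n hn α h
    obtain rfl : n = 2 + 2 * k := by omega
    rw [det_L_two_add α (h _ (by simp; omega)), ih (2 * k) rfl _ fun l hl => h _ (by simp; omega),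
      pow_succ]
    ring

theorem det_L_odd (k : ℕ) : ∀ (n : ℕ) (hn : n = 2 * k + 1) (α : Fin n → ℂ),
    (∀ l : Fin n, l.val + 1 < n → ‖α l‖ < 1) →
      (L α).det = (-1) ^ k * star (α ⟨2 * k, by omega⟩) := by
  induction k with
  | zero => rintro n rfl α -; simp [L, Fin.ext_iff]
  | succ k ih =>
    intro n hn α h
    obtain rfl : n = 2 + (2 * k + 1) := by omega
    rw [det_L_two_add α (h _ (by simp; omega)), ih (2 * k + 1) rfl _ fun l hl => h _ (by simp; omega),
      pow_succ]
    have : (Fin.natAdd 2 ⟨2 * k, by omega⟩ : Fin (2 + (2 * k + 1))) = ⟨2 * (k + 1), by omega⟩ :=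
      Fin.ext (by simp; omega)
    rw [this]
    ring

/-- After the leading 1, `M` is the matrix `L` of the shifted coefficients. -/
theorem det_M {n : ℕ} (α : Fin (n + 1) → ℂ) : (M α).det = (L fun i => α i.succ).det := by
  rw [Matrix.det_succ_row_zero, Fin.sum_univ_succ]
  have h : (M α).submatrix Fin.succ Fin.succ = L fun i => α i.succ := by
    ext i j
    have ho : ∀ k : ℕ, Odd (k + 1) ↔ Even k := fun k => by
      rw [← Nat.not_even_iff_odd, Nat.even_add_one, not_not]
    simp only [M, L, submatrix_apply, of_apply, Fin.succ_inj, Fin.val_succ, ho,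
      Nat.add_right_cancel_iff]
    by_cases hij : i = j
    · simp only [hij, if_true]
      by_cases hj : Even j.val
      · simp [hj]
      · have : j.val ≠ 0 := fun h => by rw [h] at hj; simp at hj
        simp only [hj, if_false, neg_inj, Nat.add_one_ne_zero]
        congr 1
        exact Fin.ext (by simp; omega)
    · simp [hij]
  have h1 : M α 0 0 = 1 := by simp [M]
  have h2 : ∀ i : Fin n, M α 0 i.succ = 0 := fun i => by
    simp [M, (Fin.succ_ne_zero i).symm]
  simp [h2, h, h1]

/-- Each of the m two-by-two blocks, whether in `L` or in `M`, contributes -1, and Ξ_{n-1}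
contributes the conjugate of the last coefficient. -/
theorem det_cmv {m : ℕ} (α : Fin (m + 1) → ℂ) (h : ∀ k : Fin m, ‖α k.castSucc‖ < 1) :
    (cmv α).det = (-1) ^ m * star (α (Fin.last m)) := by
  have h1 : ∀ l : Fin (m + 1), l.val + 1 < m + 1 → ‖α l‖ < 1 := fun l hl =>
    h ⟨l.val, by omega⟩
  have h2 : ∀ l : Fin m, l.val + 1 < m → ‖α l.succ‖ < 1 := fun l hl =>
    h1 l.succ (by simpa using hl)
  rw [cmv, det_mul, det_M]
  obtain ⟨k, rfl | rfl⟩ : ∃ k, m = 2 * k ∨ m = 2 * k + 1 := ⟨m / 2, by omega⟩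
  · rw [det_L_odd k _ rfl α h1, det_L_even k _ rfl _ h2]
    have : (⟨2 * k, by omega⟩ : Fin (2 * k + 1)) = Fin.last (2 * k) := rfl
    have e : (-1 : ℂ) ^ (2 * k) = (-1) ^ k * (-1) ^ k := by rw [two_mul, pow_add]
    rw [this, e]; ring
  · rw [det_L_even (k + 1) _ (by ring) α h1, det_L_odd k _ rfl _ h2]
    have : (Fin.succ ⟨2 * k, by omega⟩ : Fin (2 * k + 1 + 1)) = Fin.last (2 * k + 1) := rfl
    have e : (-1 : ℂ) ^ (2 * k + 1) = -((-1) ^ k * (-1) ^ k) := by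
      rw [pow_succ, two_mul, pow_add]; ring
    rw [this, e, pow_succ]; ring

/-! ### Moments, determinant and Krylov products from spectral data -/

theorem pow_eq_of_diagonalization {n : ℕ} {C V : Matrix (Fin n) (Fin n) ℂ} {z : Fin n → ℂ}
    (hV : V ∈ Matrix.unitaryGroup (Fin n) ℂ) (hC : C * V = V * diagonal z) (r : ℕ) :
    C ^ r = V * diagonal (fun j => z j ^ r) * star V := by
  induction r with
  | zero => simp [Matrix.mem_unitaryGroup_iff.1 hV]
  | succ r ih =>
    rw [pow_succ', ih, ← Matrix.mul_assoc, ← Matrix.mul_assoc, hC, Matrix.mul_assoc V,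
      Matrix.diagonal_mul_diagonal]
    simp only [← pow_succ']

theorem pow_apply_of_diagonalization {n : ℕ} {C V : Matrix (Fin n) (Fin n) ℂ} {z : Fin n → ℂ}
    (hV : V ∈ Matrix.unitaryGroup (Fin n) ℂ) (hC : C * V = V * diagonal z) (r : ℕ) (i k : Fin n) :
    (C ^ r) i k = ∑ j, V i j * z j ^ r * star (V k j) := by
  rw [pow_eq_of_diagonalization hV hC r, Matrix.mul_apply]
  simp [Matrix.star_apply]

theorem moment_of_hasSpectralData {n : ℕ} [NeZero n] {α : Fin n → ℂ} {θ μ : Fin n → ℝ}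
    (h : HasSpectralData (cmv α) θ μ) (r : ℕ) :
    moment α r = ∑ j, (μ j : ℂ) * Complex.exp (θ j * Complex.I) ^ r := by
  obtain ⟨V, hV, hC, hμ⟩ := h
  rw [moment, pow_apply_of_diagonalization hV hC]
  refine Finset.sum_congr rfl fun j _ => ?_
  rw [hμ, mul_right_comm]
  congr 1
  rw [Complex.star_def, Complex.mul_conj']
  push_cast; rfl

theorem det_of_hasSpectralData {n : ℕ} [NeZero n] {C : Matrix (Fin n) (Fin n) ℂ} {θ μ : Fin n → ℝ}
    (h : HasSpectralData C θ μ) : C.det = ∏ j, Complex.exp (θ j * Complex.I) := by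
  obtain ⟨V, hV, hC, -⟩ := h
  have h1 := congrArg Matrix.det hC
  rw [det_mul, det_mul, det_diagonal, mul_comm] at h1
  have h2 := congrArg Matrix.det (Matrix.mem_unitaryGroup_iff.1 hV)
  rw [det_mul, det_one] at h2
  exact mul_left_cancel₀ (left_ne_zero_of_mul_eq_one h2) h1

/-- The exponents `0, 1, -1, 2, -2, …`. -/
def zigzag (r : ℕ) : ℤ := if Even r then -((r / 2 : ℕ) : ℤ) else ((r / 2 + 1 : ℕ) : ℤ)

theorem norm_det_zigzag {n : ℕ} (z : Fin n → ℂ) (hz : ∀ j, ‖z j‖ = 1) :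
    ‖(Matrix.of fun j r : Fin n => z j ^ zigzag r).det‖ = ‖(vandermonde z).det‖ := by
  have hb : ∀ r : Fin n, 0 ≤ zigzag r + ((n - 1) / 2 : ℕ) ∧ zigzag r + ((n - 1) / 2 : ℕ) < n := by
    intro r
    have := r.isLt
    unfold zigzag
    split_ifs with h
    · omega
    · rw [Nat.even_iff] at h; omega
  -- For r < n the smallest exponent is -⌊(n-1)/2⌋. This shift makes the exponents a permutation of
  -- 0, …, n-1, and costs only unimodular row factors.
  let σ : Fin n → Fin n := fun r => ⟨(zigzag r + ((n - 1) / 2 : ℕ)).toNat, by have := hb r; omega⟩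
  have hσ : ∀ r, ((σ r : ℕ) : ℤ) = zigzag r + ((n - 1) / 2 : ℕ) := fun r => by
    simp only [σ]; exact Int.toNat_of_nonneg (hb r).1
  have hinj : Function.Injective σ := by
    intro r s h
    have h1 := hσ r
    rw [h, hσ s] at h1
    have h2 : zigzag s = zigzag r := by omega
    unfold zigzag at h2
    ext
    split_ifs at h2 with h3 h4 h4 <;> simp only [Nat.even_iff] at h3 h4 <;> omega
  let e : Equiv.Perm (Fin n) := Equiv.ofBijective σ (Finite.injective_iff_bijective.1 hinj)
  have hfac : (Matrix.of fun j r : Fin n => z j ^ zigzag r) =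
      diagonal (fun j => z j ^ (-(((n - 1) / 2 : ℕ) : ℤ))) * (vandermonde z).submatrix id e := by
    ext j r
    have hz0 : z j ≠ 0 := fun h => by have := hz j; rw [h] at this; simp at this
    rw [diagonal_mul, submatrix_apply, vandermonde_apply, of_apply]
    have : ((e r : Fin n) : ℕ) = (σ r : ℕ) := rfl
    rw [this, id, ← zpow_natCast, hσ, ← zpow_add₀ hz0]
    congr 1; ring
  rw [hfac, det_mul, det_diagonal, det_permute', norm_mul, norm_mul, norm_prod]
  have h1 : ∏ j, ‖z j ^ (-(((n - 1) / 2 : ℕ) : ℤ))‖ = 1 :=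
    Finset.prod_eq_one fun j _ => by rw [norm_zpow, hz, _root_.one_zpow]
  have h2 : ‖(((Equiv.Perm.sign e : ℤˣ) : ℤ) : ℂ)‖ = 1 := by
    rcases Int.units_eq_one_or (Equiv.Perm.sign e) with h | h <;> simp [h]
  rw [h1, h2, one_mul, one_mul]

/-- Compute the modulus of one determinant twice. The Krylov vectors, conjugated for even index,
form an upper triangular matrix. In the eigenbasis their coordinates are conj(V 0 j) times the
powers of z_j with exponents 0, 1, -1, 2, …. -/
theorem prod_krylov_diag {n : ℕ} [NeZero n] {α : Fin n → ℂ} {θ μ : Fin n → ℝ}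
    (h : HasSpectralData (cmv α) θ μ) :
    ∏ i : Fin n, ‖krylov α i i‖ ^ 2 =
      (∏ j, μ j) * ‖(vandermonde fun j => Complex.exp (θ j * Complex.I)).det‖ ^ 2 := by
  obtain ⟨V, hV, hC, hμ⟩ := h
  set z : Fin n → ℂ := fun j => Complex.exp (θ j * Complex.I) with hzdef
  have hz : ∀ j, ‖z j‖ = 1 := fun j => Complex.norm_exp_ofReal_mul_I _
  let A : Matrix (Fin n) (Fin n) ℂ := Matrix.of fun i r =>
    if Even r.val then star (krylov α r i) else krylov α r i
  have hA : A = V * diagonal (fun j => star (V 0 j)) * Matrix.of fun j r : Fin n => z j ^ zigzag r := by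
    ext i r
    rw [Matrix.mul_apply]
    simp only [Matrix.mul_diagonal, of_apply, A]
    by_cases hr : Even r.val
    · obtain ⟨t, ht⟩ := hr
      have ht : r.val = 2 * t := by omega
      rw [if_pos (by simp [ht]), ht, krylov_even, ← Matrix.transpose_pow, Matrix.mulVec_single_one,
        col_apply, transpose_apply, pow_apply_of_diagonalization hV hC, star_sum]
      refine Finset.sum_congr rfl fun j _ => ?_
      have : star (z j ^ t) = z j ^ zigzag (2 * t) := by
        simp only [zigzag, even_two, Even.mul_right, if_true]
        rw [show 2 * t / 2 = t by omega, _root_.zpow_neg, zpow_natCast, star_pow, Complex.star_def,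
          ← Complex.inv_eq_conj (hz j), inv_pow]
      rw [star_mul, star_mul, star_star, this]
      ring
    · have hr' := hr
      rw [Nat.not_even_iff_odd] at hr'
      obtain ⟨t, ht⟩ := hr'
      rw [if_neg hr, ht, krylov_odd, Matrix.mulVec_single_one, col_apply,
        pow_apply_of_diagonalization hV hC]
      refine Finset.sum_congr rfl fun j _ => ?_
      have : z j ^ (t + 1) = z j ^ zigzag (2 * t + 1) := by
        have h1 : ¬ Even (2 * t + 1) := by simp
        simp only [zigzag, h1, if_false]
        rw [show (2 * t + 1) / 2 = t by omega, zpow_natCast]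
      rw [← this]
      ring
  have hdet : A.det = ∏ i, A i i := by
    refine Matrix.det_of_isUpperTriangular fun i r hri => ?_
    have : krylov α r i = 0 := krylov_eq_zero α r i hri
    simp [A, this]
  have hVn : ‖V.det‖ = 1 := by
    have h2 := congrArg Matrix.det (Matrix.mem_unitaryGroup_iff.1 hV)
    rw [det_mul, star_eq_conjTranspose, det_conjTranspose, det_one, Complex.star_def,
      Complex.mul_conj'] at h2
    have h3 : ‖V.det‖ ^ 2 = 1 := by exact_mod_cast h2
    exact (pow_eq_one_iff_of_nonneg (norm_nonneg _) two_ne_zero).1 h3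
  have h1 : ‖A.det‖ = ∏ i : Fin n, ‖krylov α i i‖ := by
    rw [hdet, norm_prod]
    refine Finset.prod_congr rfl fun i _ => ?_
    simp only [A, of_apply]
    split_ifs <;> simp
  have h2 : ‖A.det‖ = (∏ j, ‖V 0 j‖) * ‖(vandermonde z).det‖ := by
    rw [hA, det_mul, det_mul, det_diagonal, norm_mul, norm_mul, hVn, norm_det_zigzag z hz, one_mul,
      norm_prod]
    simp
  rw [Finset.prod_pow, ← h1, h2, mul_pow, ← Finset.prod_pow]
  simp only [hμ]

/-! ### The Szegő recursion on finitely many points of the circle -/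

section Szego

/-- Multiplication by `z` in even steps, the identity in odd steps. -/
def twist {ι : Type*} (z : ι → ℂ) (k : ℕ) : ι → ℂ := if Even k then z else 1

/-- The recursion `ρ_k f_{k+1} = ζ_k f_k - a_k conj f_k` with `a_k = ∑ ζ_k f_k²`, which
orthonormalizes `1, z, z⁻¹, z², …` in `L²` of a measure on the points `z_j` with masses `s_j²`. -/
def szego {ι : Type*} [Fintype ι] (z s : ι → ℂ) : ℕ → ι → ℂ
  | 0 => s
  | k + 1 => fun j =>
      (twist z k j * szego z s k j -
        (∑ i, twist z k i * szego z s k i ^ 2) * star (szego z s k j)) /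
      rho (∑ i, twist z k i * szego z s k i ^ 2)

/-- The coefficient `a_k` in the recursion for `szego`. -/
def szegoCoeff {ι : Type*} [Fintype ι] (z s : ι → ℂ) (k : ℕ) : ℂ :=
  ∑ i, twist z k i * szego z s k i ^ 2

theorem norm_twist {ι : Type*} {z : ι → ℂ} (hz : ∀ j, ‖z j‖ = 1) (k : ℕ) (j : ι) : ‖twist z k j‖ = 1 := by
  unfold twist; split_ifs <;> simp [hz]

theorem star_twist_mul {ι : Type*} {z : ι → ℂ} (hz : ∀ j, ‖z j‖ = 1) (k : ℕ) (j : ι) :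
    star (twist z k j) * twist z k j = 1 := by
  rw [Complex.star_def, Complex.conj_mul', norm_twist hz]; simp

theorem twist_congr {ι : Type*} {z : ι → ℂ} {i k : ℕ} (h : Even (i + k)) : twist z i = twist z k := by
  unfold twist
  have : Even i ↔ Even k := by rwa [Nat.even_add] at h
  simp [this]

theorem rho_sq_complex {a : ℂ} (h : ‖a‖ ≤ 1) : (rho a : ℂ) ^ 2 = 1 - star a * a := by
  rw [Complex.star_def, Complex.conj_mul']
  exact_mod_cast rho_sq h

theorem star_rho (a : ℂ) : star (rho a : ℂ) = rho a := Complex.conj_ofReal _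

theorem rho_ne_zero {a : ℂ} (h : ‖a‖ < 1) : (rho a : ℂ) ≠ 0 :=
  Complex.ofReal_ne_zero.2 (rho_pos h).ne'

variable {ι : Type*} [Fintype ι] {z s : ι → ℂ}

theorem twist_mul_szego {k : ℕ} (h : ‖szegoCoeff z s k‖ < 1) (j : ι) :
    twist z k j * szego z s k j =
      szegoCoeff z s k * star (szego z s k j) + rho (szegoCoeff z s k) * szego z s (k + 1) j := by
  have h1 : szego z s (k + 1) j = (twist z k j * szego z s k j -
      szegoCoeff z s k * star (szego z s k j)) / rho (szegoCoeff z s k) := rfl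
  rw [h1, mul_div_cancel₀ _ (rho_ne_zero h)]
  ring

/-- Together with `twist_mul_szego` this gives the two rows of a block Ξ_k. It follows from the
first row, its conjugate and ρ² = 1 - |a|². -/
theorem twist_mul_star_szego (hz : ∀ j, ‖z j‖ = 1) {k : ℕ} (h : ‖szegoCoeff z s k‖ < 1) (j : ι) :
    twist z k j * star (szego z s (k + 1) j) =
      rho (szegoCoeff z s k) * star (szego z s k j) -
        star (szegoCoeff z s k) * szego z s (k + 1) j := by
  have h1 := twist_mul_szego h j
  have h2 := congrArg star h1
  simp only [star_mul', star_add, star_star] at h2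
  rw [star_rho] at h2
  have h3 := rho_sq_complex h.le
  have h4 := star_twist_mul hz k j
  apply mul_left_cancel₀ (rho_ne_zero h)
  linear_combination (-(twist z k j)) * h2 - star (szegoCoeff z s k) * h1 +
    star (szego z s k j) * h4 - star (szego z s k j) * h3

/-- Pythagoras: ζf and conj f are unit vectors and a is the inner product of conj f with ζf, so the
residual is that of an orthogonal projection. -/
theorem sum_szego_residual (hz : ∀ j, ‖z j‖ = 1) (k : ℕ)
    (h : ∑ j, star (szego z s k j) * szego z s k j = 1) :
    ∑ j, star (twist z k j * szego z s k j - szegoCoeff z s k * star (szego z s k j)) *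
      (twist z k j * szego z s k j - szegoCoeff z s k * star (szego z s k j)) =
      1 - star (szegoCoeff z s k) * szegoCoeff z s k := by
  set a := szegoCoeff z s k with ha
  set f := szego z s k
  have ha' : a = ∑ i, twist z k i * f i ^ 2 := rfl
  have h1 : star a = ∑ j, star (twist z k j * f j) * star (f j) := by
    rw [ha', star_sum]
    exact Finset.sum_congr rfl fun j _ => by rw [pow_two, ← mul_assoc, star_mul']
  have h2 : a = ∑ j, f j * (twist z k j * f j) := by
    rw [ha']
    exact Finset.sum_congr rfl fun j _ => by ring
  have e : ∀ j, star (twist z k j * f j - a * star (f j)) * (twist z k j * f j - a * star (f j)) =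
      star (f j) * f j - a * (star (twist z k j * f j) * star (f j)) -
        star a * (f j * (twist z k j * f j)) + star a * a * (star (f j) * f j) := by
    intro j
    have h4 := star_twist_mul hz k j
    simp only [star_mul', star_sub, star_star]
    linear_combination (star (f j) * f j) * h4
  rw [Finset.sum_congr rfl fun j _ => e j, Finset.sum_add_distrib, Finset.sum_sub_distrib,
    Finset.sum_sub_distrib, ← Finset.mul_sum, ← Finset.mul_sum, ← Finset.mul_sum, h, ← h1, ← h2]
  ring

theorem szego_normalized (hz : ∀ j, ‖z j‖ = 1) (hs : ∑ j, star (s j) * s j = 1) (k : ℕ)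
    (h : ∀ l < k, ‖szegoCoeff z s l‖ < 1) : ∑ j, star (szego z s k j) * szego z s k j = 1 := by
  induction k with
  | zero => exact hs
  | succ k ih =>
    have h1 := sum_szego_residual hz k (ih fun l hl => h l (by omega))
    have hk := h k (by omega)
    have e : ∀ j, twist z k j * szego z s k j - szegoCoeff z s k * star (szego z s k j) =
        rho (szegoCoeff z s k) * szego z s (k + 1) j := fun j => by
      rw [twist_mul_szego hk j]; ring
    simp only [e, star_mul'] at h1
    rw [star_rho, ← rho_sq_complex hk.le] at h1
    apply mul_left_cancel₀ (pow_ne_zero 2 (rho_ne_zero hk))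
    rw [mul_one, Finset.mul_sum]
    refine Eq.trans ?_ h1
    exact Finset.sum_congr rfl fun j _ => by ring

theorem norm_szegoCoeff_sq (hz : ∀ j, ‖z j‖ = 1) (k : ℕ)
    (h : ∑ j, star (szego z s k j) * szego z s k j = 1) :
    ∑ j, ‖twist z k j * szego z s k j - szegoCoeff z s k * star (szego z s k j)‖ ^ 2 =
      1 - ‖szegoCoeff z s k‖ ^ 2 := by
  have h1 := sum_szego_residual hz k h
  simp only [Complex.star_def, Complex.conj_mul'] at h1
  simp only [Complex.star_def]
  exact_mod_cast h1

open Polynomial in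
-- Up to the scale c = ∏ρ_l, p and q are the monic orthogonal polynomial and its reversal, with
-- recursion p ↦ Xp - aq, q ↦ q - conj(a)Xp. The powers of z clear the negative exponents.
theorem exists_szego_polynomial (hs : ∀ j, star (s j) = s j) (hz : ∀ j, ‖z j‖ = 1)
    (k : ℕ) (h : ∀ l < k, ‖szegoCoeff z s l‖ < 1) :
    ∃ (c : ℂ) (p q : ℂ[X]), c ≠ 0 ∧ p.Monic ∧ p.natDegree = k ∧ q.natDegree ≤ k ∧
      (∀ j, c * szego z s k j * z j ^ (k / 2) = s j * p.eval (z j)) ∧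
      (∀ j, c * star (szego z s k j) * z j ^ ((k + 1) / 2) = s j * q.eval (z j)) := by
  induction k with
  | zero =>
    exact ⟨1, 1, 1, one_ne_zero, monic_one, by simp, by simp, fun j => by simp [szego],
      fun j => by simp [szego, hs]⟩
  | succ k ih =>
    obtain ⟨c, p, q, hc, hp, hpk, hq, h1, h2⟩ := ih fun l hl => h l (by omega)
    have hk := h k (by omega)
    set a := szegoCoeff z s k
    have hlt : (C a * q).natDegree < (X * p).natDegree := by
      rw [natDegree_X_mul hp.ne_zero, hpk]
      exact lt_of_le_of_lt (natDegree_C_mul_le _ _) (by omega)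
    have hlt' : (C a * q).degree < (X * p).degree := degree_lt_degree hlt
    refine ⟨c * rho a, X * p - C a * q, q - C (star a) * (X * p),
      mul_ne_zero hc (rho_ne_zero hk), (monic_X.mul hp).sub_of_left hlt', ?_, ?_, ?_, ?_⟩
    · rw [natDegree_sub_eq_left_of_natDegree_lt hlt, natDegree_X_mul hp.ne_zero, hpk]
    · refine (natDegree_sub_le _ _).trans (max_le (by omega) ((natDegree_C_mul_le _ _).trans ?_))
      rw [natDegree_X_mul hp.ne_zero, hpk]
    · intro j
      have e := twist_mul_szego hk j
      simp only [eval_sub, eval_mul, eval_X, eval_C]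
      obtain ⟨t, rfl | rfl⟩ : ∃ t, k = 2 * t ∨ k = 2 * t + 1 := ⟨k / 2, by omega⟩
      · have h1 := h1 j
        have h2 := h2 j
        simp only [twist, even_two, Even.mul_right, if_true] at e
        rw [show 2 * t / 2 = t by omega] at h1
        rw [show (2 * t + 1) / 2 = t by omega] at h2 ⊢
        linear_combination z j * h1 - a * h2 - c * z j ^ t * e
      · have h1 := h1 j
        have h2 := h2 j
        have ho : ¬ Even (2 * t + 1) := by simp
        simp only [twist, ho, if_false, Pi.one_apply, one_mul] at e
        rw [show (2 * t + 1) / 2 = t by omega] at h1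
        rw [show (2 * t + 1 + 1) / 2 = t + 1 by omega] at h2 ⊢
        linear_combination z j * h1 - a * h2 - c * z j ^ (t + 1) * e
    · intro j
      have e := congrArg star (twist_mul_szego hk j)
      have hzj : star (z j) * z j = 1 := by
        rw [Complex.star_def, Complex.conj_mul', hz]; simp
      simp only [star_mul', star_add, star_star] at e
      rw [star_rho] at e
      simp only [eval_sub, eval_mul, eval_X, eval_C]
      obtain ⟨t, rfl | rfl⟩ : ∃ t, k = 2 * t ∨ k = 2 * t + 1 := ⟨k / 2, by omega⟩
      · have h1 := h1 j
        have h2 := h2 j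
        simp only [twist, even_two, Even.mul_right, if_true] at e
        rw [show 2 * t / 2 = t by omega] at h1
        rw [show (2 * t + 1) / 2 = t by omega] at h2
        rw [show (2 * t + 1 + 1) / 2 = t + 1 by omega]
        linear_combination h2 - star a * z j * h1 - c * z j ^ (t + 1) * e +
          c * star (szego z s (2 * t) j) * z j ^ t * hzj
      · have h1 := h1 j
        have h2 := h2 j
        have ho : ¬ Even (2 * t + 1) := by simp
        simp only [twist, ho, if_false, Pi.one_apply, star_one, one_mul] at e
        rw [show (2 * t + 1) / 2 = t by omega] at h1
        rw [show (2 * t + 1 + 1) / 2 = t + 1 by omega] at h2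
        rw [show (2 * t + 1 + 1 + 1) / 2 = t + 1 by omega]
        linear_combination h2 - star a * z j * h1 - c * z j ^ (t + 1) * e

open Polynomial in
-- If |a_k| ≥ 1, the residual vanishes at every point. Then Xp - aq, of degree k + 1, has more
-- distinct zeros than its degree.
theorem norm_szegoCoeff_lt_one (hs : ∀ j, star (s j) = s j) (hs0 : ∀ j, s j ≠ 0)
    (hs1 : ∑ j, star (s j) * s j = 1) (hz : ∀ j, ‖z j‖ = 1) (hinj : Function.Injective z)
    (k : ℕ) (hk : k + 1 < Fintype.card ι) : ‖szegoCoeff z s k‖ < 1 := by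
  induction k using Nat.strong_induction_on with
  | _ k ih =>
    have ih : ∀ l < k, ‖szegoCoeff z s l‖ < 1 := fun l hl => ih l hl (by omega)
    have h1 := norm_szegoCoeff_sq hz k (szego_normalized hz hs1 k ih)
    have h0 : 0 ≤ ∑ j, ‖twist z k j * szego z s k j - szegoCoeff z s k * star (szego z s k j)‖ ^ 2 :=
      Finset.sum_nonneg fun j _ => sq_nonneg _
    by_contra hcon
    have h2 : ∑ j, ‖twist z k j * szego z s k j - szegoCoeff z s k * star (szego z s k j)‖ ^ 2 = 0 := by
      refine le_antisymm ?_ h0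
      rw [h1]; nlinarith [norm_nonneg (szegoCoeff z s k)]
    rw [Finset.sum_eq_zero_iff_of_nonneg fun j _ => sq_nonneg _] at h2
    have h3 : ∀ j, twist z k j * szego z s k j = szegoCoeff z s k * star (szego z s k j) :=
      fun j => sub_eq_zero.1 (norm_eq_zero.1 (pow_eq_zero_iff two_ne_zero |>.1 (h2 j (Finset.mem_univ _))))
    obtain ⟨c, p, q, hc, hp, hpk, hq, e1, e2⟩ := exists_szego_polynomial hs hz k ih
    set a := szegoCoeff z s k
    have hlt : (C a * q).natDegree < (X * p).natDegree := by
      rw [natDegree_X_mul hp.ne_zero, hpk]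
      exact lt_of_le_of_lt (natDegree_C_mul_le _ _) (by omega)
    have hdeg : (X * p - C a * q).natDegree = k + 1 := by
      rw [natDegree_sub_eq_left_of_natDegree_lt hlt, natDegree_X_mul hp.ne_zero, hpk]
    have hzero : X * p - C a * q = 0 := by
      refine eq_zero_of_natDegree_lt_card_of_eval_eq_zero _ hinj (fun j => ?_) (by rw [hdeg]; exact hk)
      simp only [eval_sub, eval_mul, eval_X, eval_C]
      apply mul_left_cancel₀ (hs0 j)
      have e := h3 j
      have e1 := e1 j
      have e2 := e2 j
      obtain ⟨t, rfl | rfl⟩ : ∃ t, k = 2 * t ∨ k = 2 * t + 1 := ⟨k / 2, by omega⟩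
      · simp only [twist, even_two, Even.mul_right, if_true] at e
        rw [show 2 * t / 2 = t by omega] at e1
        rw [show (2 * t + 1) / 2 = t by omega] at e2
        linear_combination a * e2 - z j * e1 + c * z j ^ t * e
      · have ho : ¬ Even (2 * t + 1) := by simp
        simp only [twist, ho, if_false, Pi.one_apply, one_mul] at e
        rw [show (2 * t + 1) / 2 = t by omega] at e1
        rw [show (2 * t + 1 + 1) / 2 = t + 1 by omega] at e2
        linear_combination a * e2 - z j * e1 + c * z j ^ (t + 1) * e
    rw [hzero] at hdeg
    simp at hdeg

/-- `f_i` or its conjugate, according to the parity of `k - i`. -/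
def szegoAlign (z s : ι → ℂ) (k i : ℕ) (j : ι) : ℂ :=
  if Even (i + k) then szego z s i j else star (szego z s i j)

theorem szegoAlign_succ (k i : ℕ) (j : ι) :
    szegoAlign z s (k + 1) i j = star (szegoAlign z s k i j) := by
  have : Even (i + (k + 1)) ↔ ¬ Even (i + k) := by rw [← add_assoc, Nat.even_add_one]
  unfold szegoAlign
  by_cases h : Even (i + k) <;> simp [this, h]

/-- Multiplication by ζ_k is unitary, so it suffices to write the conjugate of the i-th aligned
function as ζ_k times a combination of aligned functions of index below k. Inverting the block that
contains i does this. -/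
theorem sum_szegoAlign_mul_twist (hs : ∀ j, star (s j) = s j) (hz : ∀ j, ‖z j‖ = 1) (k : ℕ)
    (h : ∀ l < k, ‖szegoCoeff z s l‖ < 1)
    (ho : ∀ i < k, ∑ j, star (szegoAlign z s k i j) * szego z s k j = 0) (i : ℕ) (hi : i < k) :
    ∑ j, szegoAlign z s k i j * (twist z k j * szego z s k j) = 0 := by
  have unit : ∀ j, star (twist z k j) * twist z k j = 1 := star_twist_mul hz k
  have comb : ∀ (b d : ℂ) (i' i'' : ℕ), i' < k → i'' < k →
      (∀ j, star (szegoAlign z s k i j) =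
        b * (twist z k j * szegoAlign z s k i' j) + d * (twist z k j * szegoAlign z s k i'' j)) →
      ∑ j, szegoAlign z s k i j * (twist z k j * szego z s k j) = 0 := by
    intro b d i' i'' h' h'' e
    have e' : ∀ j, szegoAlign z s k i j * (twist z k j * szego z s k j) =
        star b * (star (szegoAlign z s k i' j) * szego z s k j) +
          star d * (star (szegoAlign z s k i'' j) * szego z s k j) := by
      intro j
      have e1 := congrArg star (e j)
      simp only [star_star, star_add, star_mul'] at e1
      rw [e1]
      linear_combination (star b * star (szegoAlign z s k i' j) * szego z s k j +
        star d * star (szegoAlign z s k i'' j) * szego z s k j) * unit j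
    rw [Finset.sum_congr rfl fun j _ => e' j, Finset.sum_add_distrib, ← Finset.mul_sum,
      ← Finset.mul_sum, ho i' h', ho i'' h'', mul_zero, mul_zero, add_zero]
  by_cases he : Even (i + k)
  -- The block partner of i is i + 1, and parity excludes i + 1 = k.
  · have hik : i + 1 < k := by
      rcases Nat.lt_or_ge (i + 1) k with h | h
      · exact h
      · have : i + k = 2 * i + 1 := by omega
        rw [this] at he; simp at he
    have ho' : ¬ Even (i + 1 + k) := by
      rw [add_right_comm, Nat.even_add_one]; simpa using he
    refine comb (star (szegoCoeff z s i)) (rho (szegoCoeff z s i)) i (i + 1) hi hik fun j => ?_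
    simp only [szegoAlign, he, ho', if_true, if_false]
    rw [← twist_congr he, twist_mul_szego (h i hi), twist_mul_star_szego hz (h i hi)]
    linear_combination (-star (szego z s i j)) * rho_sq_complex (h i hi).le
  · obtain _ | l := i
    -- Index 0 has no partner here; for odd k the twist is trivial, and the initial function is
    -- real.
    · have hk : ¬ Even k := by simpa using he
      refine comb 1 0 0 0 hi hi fun j => ?_
      simp [szegoAlign, twist, hk, szego, hs]
    · have he' : Even (l + k) := by
        rw [add_right_comm, Nat.even_add_one, not_not] at he; exact he
      have hl := h l (by omega)
      refine comb (rho (szegoCoeff z s l)) (-szegoCoeff z s l) l (l + 1) (by omega) hi fun j => ?_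
      simp only [szegoAlign, he, he', if_true, if_false, star_star]
      rw [← twist_congr he', twist_mul_szego hl, twist_mul_star_szego hz hl]
      linear_combination (-szego z s (l + 1) j) * rho_sq_complex hl.le

/-- Raising k conjugates the aligned functions. For i < k, both terms of ρ_k f_{k+1} = ζ_k f_k - a_k
conj f_k drop out; for i = k they cancel by the choice of a_k. -/
theorem szego_orthogonal (hs : ∀ j, star (s j) = s j) (hs1 : ∑ j, star (s j) * s j = 1)
    (hz : ∀ j, ‖z j‖ = 1) (k : ℕ) (h : ∀ l < k, ‖szegoCoeff z s l‖ < 1) (i : ℕ) (hi : i < k) :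
    ∑ j, star (szegoAlign z s k i j) * szego z s k j = 0 := by
  induction k generalizing i with
  | zero => omega
  | succ k ih =>
    have h' : ∀ l < k, ‖szegoCoeff z s l‖ < 1 := fun l hl => h l (by omega)
    have hk := h k (by omega)
    have ih := ih h'
    apply mul_left_cancel₀ (rho_ne_zero hk)
    rw [mul_zero, Finset.mul_sum]
    have e : ∀ j, (rho (szegoCoeff z s k) : ℂ) *
        (star (szegoAlign z s (k + 1) i j) * szego z s (k + 1) j) =
        szegoAlign z s k i j * (twist z k j * szego z s k j) -
          szegoCoeff z s k * (szegoAlign z s k i j * star (szego z s k j)) := by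
      intro j
      rw [szegoAlign_succ, star_star, twist_mul_szego hk]
      ring
    rw [Finset.sum_congr rfl fun j _ => e j, Finset.sum_sub_distrib, ← Finset.mul_sum]
    rcases Nat.lt_succ_iff_lt_or_eq.1 hi with hi | rfl
    · rw [sum_szegoAlign_mul_twist hs hz k h' ih i hi]
      have e2 := congrArg star (ih i hi)
      rw [star_sum, star_zero] at e2
      simp only [star_mul', star_star] at e2
      rw [e2]; ring
    · have hn := szego_normalized hz hs1 i h'
      have ea : ∀ j, szegoAlign z s i i j = szego z s i j := fun j => by simp [szegoAlign]
      simp only [ea]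
      have e3 : ∑ j, szego z s i j * star (szego z s i j) = 1 := by
        rw [← hn]; exact Finset.sum_congr rfl fun j _ => mul_comm _ _
      have e4 : ∑ j, szego z s i j * (twist z i j * szego z s i j) = szegoCoeff z s i :=
        Finset.sum_congr rfl fun j _ => by ring
      rw [e3, e4]; ring

end Szego

/-! ### A CMV matrix with prescribed spectral data -/

/-- The rows are the orthonormal functions `szego`, conjugated in odd steps. -/
def szegoMatrix {m : ℕ} (z s : Fin (m + 1) → ℂ) : Matrix (Fin (m + 1)) (Fin (m + 1)) ℂ :=
  Matrix.of fun i j => szegoAlign z s 0 i j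

theorem szegoAlign_of_even {ι : Type*} [Fintype ι] {z s : ι → ℂ} {k : ℕ} (hk : Even k) (i : ℕ)
    (j : ι) : szegoAlign z s k i j = szegoAlign z s 0 i j := by
  simp [szegoAlign, Nat.even_add, hk]

theorem szegoAlign_of_not_even {ι : Type*} [Fintype ι] {z s : ι → ℂ} {k : ℕ} (hk : ¬ Even k)
    (i : ℕ) (j : ι) : szegoAlign z s k i j = star (szegoAlign z s 0 i j) := by
  simp only [szegoAlign, Nat.even_add, hk, iff_false, add_zero]
  by_cases h : Even i <;> simp [h]

theorem szegoAlign_self {ι : Type*} [Fintype ι] {z s : ι → ℂ} (k : ℕ) (j : ι) :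
    szegoAlign z s k k j = szego z s k j := by
  simp [szegoAlign]

theorem szegoMatrix_mem_unitaryGroup {m : ℕ} {z s : Fin (m + 1) → ℂ} (hs : ∀ j, star (s j) = s j)
    (hs1 : ∑ j, star (s j) * s j = 1) (hz : ∀ j, ‖z j‖ = 1)
    (ha : ∀ k < m, ‖szegoCoeff z s k‖ < 1) :
    szegoMatrix z s ∈ Matrix.unitaryGroup (Fin (m + 1)) ℂ := by
  have key : ∀ i k : Fin (m + 1), i < k →
      ∑ j, star (szegoMatrix z s i j) * szegoMatrix z s k j = 0 := by
    intro i k hik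
    have h := szego_orthogonal hs hs1 hz k (fun l hl => ha l (by have := k.isLt; omega)) i hik
    simp only [szegoMatrix, of_apply]
    simp only [← szegoAlign_self k.val] at h
    by_cases hk : Even k.val
    · simpa only [szegoAlign_of_even hk] using h
    · simp only [szegoAlign_of_not_even hk, star_star] at h
      have h' := congrArg star h
      rw [star_sum, star_zero] at h'
      simpa only [star_mul', star_star] using h'
  have diag : ∀ k : Fin (m + 1), ∑ j, star (szegoMatrix z s k j) * szegoMatrix z s k j = 1 := by
    intro k
    have h := szego_normalized hz hs1 k (fun l hl => ha l (by have := k.isLt; omega))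
    simp only [szegoMatrix, of_apply]
    rw [← h]
    refine Finset.sum_congr rfl fun j _ => ?_
    simp only [szegoAlign]
    split_ifs
    · rfl
    · rw [star_star, mul_comm]
  rw [Matrix.mem_unitaryGroup_iff]
  ext i k
  rw [Matrix.mul_apply]
  simp only [Matrix.star_apply]
  rcases lt_trichotomy i k with h | rfl | h
  · have h' := congrArg star (key i k h)
    rw [star_sum, star_zero] at h'
    simp only [star_mul', star_star] at h'
    rw [h', Matrix.one_apply_ne h.ne]
  · rw [Matrix.one_apply_eq, ← diag i]
    exact Finset.sum_congr rfl fun j _ => mul_comm _ _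
  · rw [Matrix.one_apply_ne h.ne', ← key k i h]
    exact Finset.sum_congr rfl fun j _ => mul_comm _ _

/-- The recursion must stop: the next residual is orthogonal to m + 1 orthonormal vectors in a space
of dimension m + 1, so it is 0. -/
theorem twist_mul_szego_last {m : ℕ} {z s : Fin (m + 1) → ℂ} (hs : ∀ j, star (s j) = s j)
    (hs1 : ∑ j, star (s j) * s j = 1) (hz : ∀ j, ‖z j‖ = 1)
    (ha : ∀ k < m, ‖szegoCoeff z s k‖ < 1)
    (j : Fin (m + 1)) :
    twist z m j * szego z s m j = szegoCoeff z s m * star (szego z s m j) := by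
  have hU := szegoMatrix_mem_unitaryGroup hs hs1 hz ha
  have hinj : ∀ v : Fin (m + 1) → ℂ, szegoMatrix z s *ᵥ v = 0 → v = 0 := by
    intro v hv
    have := congrArg (fun w => star (szegoMatrix z s) *ᵥ w) hv
    simpa [Matrix.mulVec_mulVec, Matrix.mem_unitaryGroup_iff'.1 hU] using this
  let v : Fin (m + 1) → ℂ := fun j =>
    twist z m j * szego z s m j - szegoCoeff z s m * star (szego z s m j)
  have horth : ∀ i : Fin (m + 1), ∑ j, szegoAlign z s m i j * v j = 0 := by
    intro i
    simp only [v, mul_sub, Finset.sum_sub_distrib]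
    have e : ∑ j, szegoAlign z s m i j * (szegoCoeff z s m * star (szego z s m j)) =
        szegoCoeff z s m * star (∑ j, star (szegoAlign z s m i j) * szego z s m j) := by
      rw [star_sum, Finset.mul_sum]
      exact Finset.sum_congr rfl fun j _ => by rw [star_mul', star_star]; ring
    rw [e]
    rcases Nat.lt_succ_iff_lt_or_eq.1 i.isLt with hi | hi
    · rw [sum_szegoAlign_mul_twist hs hz m ha
          (fun i hi => szego_orthogonal hs hs1 hz m ha i hi) i hi,
        szego_orthogonal hs hs1 hz m ha i hi]
      simp
    · simp only [hi, szegoAlign_self]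
      rw [szego_normalized hz hs1 m ha, star_one, mul_one, sub_eq_zero]
      exact Finset.sum_congr rfl fun j _ => by ring
  have hv : v = 0 := by
    by_cases hm : Even m
    · refine hinj v (funext fun i => ?_)
      have h' := horth i
      simp only [szegoAlign_of_even hm] at h'
      exact h'
    · have : star v = 0 := by
        refine hinj (star v) (funext fun i => ?_)
        have h' := congrArg star (horth i)
        rw [star_sum, star_zero] at h'
        simp only [szegoAlign_of_not_even hm, star_mul', star_star] at h'
        exact h'
      simpa using this
  exact sub_eq_zero.1 (congrFun hv j)

theorem norm_szegoCoeff_last {m : ℕ} {z s : Fin (m + 1) → ℂ} (hs : ∀ j, star (s j) = s j)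
    (hs1 : ∑ j, star (s j) * s j = 1) (hz : ∀ j, ‖z j‖ = 1)
    (ha : ∀ k < m, ‖szegoCoeff z s k‖ < 1) :
    ‖szegoCoeff z s m‖ = 1 := by
  have h := norm_szegoCoeff_sq hz m (szego_normalized hz hs1 m ha)
  simp only [twist_mul_szego_last hs hs1 hz ha, sub_self, norm_zero] at h
  have h1 : ‖szegoCoeff z s m‖ ^ 2 = 1 := by
    rw [Finset.sum_eq_zero fun j _ => by simp] at h; linarith
  exact (pow_eq_one_iff_of_nonneg (norm_nonneg _) two_ne_zero).1 h1

/-- With α_k = conj a_k, the two Szegő relations are the rows of the blocks. The unpaired rows use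
that the initial function is real and that the recursion terminates. -/
theorem factor_mulVec_szego {m : ℕ} {z s : Fin (m + 1) → ℂ} (hs : ∀ j, star (s j) = s j)
    (hs1 : ∑ j, star (s j) * s j = 1) (hz : ∀ j, ‖z j‖ = 1)
    (ha : ∀ k < m, ‖szegoCoeff z s k‖ < 1)
    (r : ℕ) (j : Fin (m + 1)) :
    factor (fun i : Fin (m + 1) => star (szegoCoeff z s i)) r *ᵥ
        (fun i : Fin (m + 1) => star (szegoAlign z s r i j)) =
      fun i : Fin (m + 1) => twist z r j * szegoAlign z s r i j := by
  ext i
  rcases factor_row_cases r i with ⟨he, k, hk⟩ | ⟨he, hn⟩ | ⟨k, hk, he⟩ | ⟨h0, h1⟩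
  · have hi := ha i (by have := k.isLt; omega)
    have ho : ¬ Even (i.val + 1 + r) := by
      rw [add_right_comm, Nat.even_add_one]; simpa using he
    rw [factor_mulVec_top _ r _ i k hk he, hk, ← twist_congr he]
    simp only [szegoAlign, he, ho, if_true, if_false, star_star]
    rw [twist_mul_szego hi, rho, rho, norm_star]
  · have hi : i.val = m := by omega
    rw [factor_mulVec_last _ r _ i hn he, ← twist_congr he, hi]
    rw [hi] at he
    simp only [szegoAlign, he, if_true, star_star]
    rw [twist_mul_szego_last hs hs1 hz ha]
  · have hi := ha k (by have := i.isLt; omega)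
    have ho : ¬ Even (k.val + 1 + r) := by
      rw [add_right_comm, Nat.even_add_one]; simpa using he
    rw [factor_mulVec_bot _ r _ k i hk he, hk, ← twist_congr he]
    simp only [szegoAlign, he, ho, if_true, if_false, star_star]
    rw [twist_mul_star_szego hz hi, rho, rho, norm_star]
  · rw [factor_mulVec_zero _ r _ i h0 h1]
    simp [szegoAlign, h0, h1, szego, hs, twist]

theorem cmv_mul_szegoMatrix {m : ℕ} {z s : Fin (m + 1) → ℂ} (hs : ∀ j, star (s j) = s j)
    (hs1 : ∑ j, star (s j) * s j = 1) (hz : ∀ j, ‖z j‖ = 1)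
    (ha : ∀ k < m, ‖szegoCoeff z s k‖ < 1) :
    cmv (fun i : Fin (m + 1) => star (szegoCoeff z s i)) * szegoMatrix z s =
      szegoMatrix z s * diagonal z := by
  have hL : L (fun i : Fin (m + 1) => star (szegoCoeff z s i)) =
      factor (fun i : Fin (m + 1) => star (szegoCoeff z s i)) 0 := by simp [factor]
  have hM : M (fun i : Fin (m + 1) => star (szegoCoeff z s i)) =
      factor (fun i : Fin (m + 1) => star (szegoCoeff z s i)) 1 := by simp [factor]
  have h0 := factor_mulVec_szego hs hs1 hz ha 0
  have h1 := factor_mulVec_szego hs hs1 hz ha 1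
  ext i j
  have hcol : (fun i : Fin (m + 1) => szegoMatrix z s i j) =
      fun i : Fin (m + 1) => star (szegoAlign z s 1 i j) := by
    ext i
    rw [szegoAlign_succ, star_star]; rfl
  have hmid : (fun i : Fin (m + 1) => twist z 1 j * szegoAlign z s 1 i j) =
      fun i : Fin (m + 1) => star (szegoAlign z s 0 i j) := by
    ext i
    rw [szegoAlign_succ]
    simp [twist]
  rw [Matrix.mul_diagonal]
  change (cmv _ *ᵥ fun i => szegoMatrix z s i j) i = _
  rw [cmv, ← Matrix.mulVec_mulVec, hcol, hM, h1 j, hmid, hL, h0 j]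
  simp [twist, szegoMatrix, mul_comm]

theorem exists_hasSpectralData {m : ℕ} (θ μ : Fin (m + 1) → ℝ)
    (hinj : Function.Injective fun j => Complex.exp (θ j * Complex.I)) (hμ : ∀ j, 0 < μ j)
    (hsum : ∑ j, μ j = 1) :
    ∃ α : Fin (m + 1) → ℂ, (∀ k : Fin m, ‖α k.castSucc‖ < 1) ∧ ‖α (Fin.last m)‖ = 1 ∧
      HasSpectralData (cmv α) θ μ := by
  set z : Fin (m + 1) → ℂ := fun j => Complex.exp (θ j * Complex.I) with hzdef
  have hz : ∀ j, ‖z j‖ = 1 := fun j => Complex.norm_exp_ofReal_mul_I _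
  -- These values form the first row of the eigenvector matrix, so their squares must be the masses.
  let s : Fin (m + 1) → ℂ := fun j => (Real.sqrt (μ j) : ℝ)
  have hs : ∀ j, star (s j) = s j := fun j => Complex.conj_ofReal _
  have hs0 : ∀ j, s j ≠ 0 := fun j => Complex.ofReal_ne_zero.2 (Real.sqrt_pos.2 (hμ j)).ne'
  have hs1 : ∑ j, star (s j) * s j = 1 := by
    have : ∀ j, star (s j) * s j = (μ j : ℂ) := fun j => by
      rw [hs]
      simp only [s]
      rw [← Complex.ofReal_mul, Real.mul_self_sqrt (hμ j).le]
    simp only [this]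
    exact_mod_cast hsum
  have ha : ∀ k < m, ‖szegoCoeff z s k‖ < 1 := fun k hk =>
    norm_szegoCoeff_lt_one hs hs0 hs1 hz hinj k (by simpa using hk)
  refine ⟨fun i => star (szegoCoeff z s i), fun k => ?_, ?_, szegoMatrix z s,
    szegoMatrix_mem_unitaryGroup hs hs1 hz ha, cmv_mul_szegoMatrix hs hs1 hz ha, fun j => ?_⟩
  · rw [norm_star]; exact ha _ k.isLt
  · rw [norm_star]; exact norm_szegoCoeff_last hs hs1 hz ha
  · have : szegoMatrix z s 0 j = s j := by simp [szegoMatrix, szegoAlign, szego]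
    rw [this]
    simp only [s, Complex.norm_real, Real.norm_eq_abs, sq_abs]
    rw [Real.sq_sqrt (hμ j).le]

/-! ### Moments in the spectral parameters, and differentiability of the change of variables -/

/-- The angle `θ_j` as a linear function. -/
def thetaCLM {m : ℕ} (j : Fin (m + 1)) : Coord m →L[ℝ] ℝ :=
  LinearMap.toContinuousLinearMap
    { toFun := fun x => theta x j
      map_add' := fun x y => by refine Fin.lastCases ?_ (fun k => ?_) j <;> simp [theta]
      map_smul' := fun c x => by refine Fin.lastCases ?_ (fun k => ?_) j <;> simp [theta] }

/-- The linear part of the affine function `μ_j`. -/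
def massCLM {m : ℕ} (j : Fin (m + 1)) : Coord m →L[ℝ] ℝ :=
  LinearMap.toContinuousLinearMap
    { toFun := fun x =>
        (Fin.snoc (fun k => (x.1 k).2) (-∑ k, (x.1 k).2) : Fin (m + 1) → ℝ) j
      map_add' := fun x y => by
        refine Fin.lastCases ?_ (fun k => ?_) j <;> simp [Finset.sum_add_distrib, add_comm]
      map_smul' := fun c x => by
        refine Fin.lastCases ?_ (fun k => ?_) j <;> simp [Finset.mul_sum] }

theorem massCLM_castSucc {m : ℕ} (k : Fin m) (x : Coord m) :
    massCLM k.castSucc x = (x.1 k).2 := by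
  change (Fin.snoc (fun k => (x.1 k).2) (-∑ k, (x.1 k).2) : Fin (m + 1) → ℝ) k.castSucc = _
  simp

theorem massCLM_last {m : ℕ} (x : Coord m) :
    massCLM (Fin.last m) x = -∑ k, (x.1 k).2 := by
  change (Fin.snoc (fun k => (x.1 k).2) (-∑ k, (x.1 k).2) : Fin (m + 1) → ℝ) (Fin.last m) = _
  simp

theorem hasFDerivAt_theta {m : ℕ} (j : Fin (m + 1)) (x : Coord m) :
    HasFDerivAt (fun x => theta x j) (thetaCLM j) x := (thetaCLM j).hasFDerivAt

theorem mass_eq {m : ℕ} (j : Fin (m + 1)) (x : Coord m) :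
    mass x j = massCLM j x + if j = Fin.last m then 1 else 0 := by
  refine Fin.lastCases ?_ (fun k => ?_) j
  · simp [mass, massCLM_last]; ring
  · simp [mass, massCLM_castSucc, (Fin.castSucc_lt_last k).ne]

theorem hasFDerivAt_mass {m : ℕ} (j : Fin (m + 1)) (x : Coord m) :
    HasFDerivAt (fun x => mass x j) (massCLM j) x := by
  rw [funext (mass_eq j)]
  exact (massCLM j).hasFDerivAt.add_const _

theorem sum_mass {m : ℕ} (x : Coord m) : ∑ j, mass x j = 1 := by
  rw [Fin.sum_univ_castSucc]; simp [mass]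

/-- The point `e^{iθ_j}`. -/
def point {m : ℕ} (x : Coord m) (j : Fin (m + 1)) : ℂ := Complex.exp (theta x j * Complex.I)

theorem norm_point {m : ℕ} (x : Coord m) (j : Fin (m + 1)) : ‖point x j‖ = 1 :=
  Complex.norm_exp_ofReal_mul_I _

/-- The moment `∑ μ_j e^{ikθ_j}` of the measure with parameters `x`. -/
def specMoment {m : ℕ} (k : ℤ) (x : Coord m) : ℂ := ∑ j, (mass x j : ℂ) * point x j ^ k

/-- The derivative of `specMoment k` at `x`. -/
def specMomentDeriv {m : ℕ} (k : ℤ) (x : Coord m) : Coord m →L[ℝ] ℂ :=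
  ∑ j, ((point x j ^ k) • Complex.ofRealCLM.comp (massCLM j) +
    ((mass x j : ℂ) * (k * Complex.I * point x j ^ k)) • Complex.ofRealCLM.comp (thetaCLM j))

theorem hasFDerivAt_specMoment {m : ℕ} (k : ℤ) (x : Coord m) :
    HasFDerivAt (specMoment k) (specMomentDeriv k x) x := by
  refine HasFDerivAt.fun_sum fun j _ => ?_
  have h1 : HasFDerivAt (fun x => (mass x j : ℂ)) (Complex.ofRealCLM.comp (massCLM j)) x :=
    Complex.ofRealCLM.hasFDerivAt.comp x (hasFDerivAt_mass j x)
  have h2 : HasFDerivAt (fun x => (theta x j : ℂ)) (Complex.ofRealCLM.comp (thetaCLM j)) x :=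
    Complex.ofRealCLM.hasFDerivAt.comp x (hasFDerivAt_theta j x)
  have h3 : HasFDerivAt (fun x => point x j ^ k)
      ((k * Complex.I * point x j ^ k) • Complex.ofRealCLM.comp (thetaCLM j)) x := by
    have h4 := (h2.const_mul ((k : ℂ) * Complex.I)).cexp
    have e : ∀ y : Coord m, point y j ^ k = Complex.exp (k * Complex.I * theta y j) := fun y => by
      rw [point, ← Complex.exp_int_mul]; congr 1; ring
    rw [funext e]
    refine h4.congr_fderiv ?_
    rw [smul_smul, e x, mul_comm]
  refine (h1.mul h3).congr_fderiv ?_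
  rw [smul_smul, add_comm]

theorem Corresponds.moment_eq {m : ℕ} {x y : Coord m} (h : Corresponds x y) (r : ℕ) :
    moment (verblunsky y) r = specMoment r x := by
  rw [moment_of_hasSpectralData h.2]
  simp [specMoment, point]

theorem Corresponds.norm_lt {m : ℕ} {x y : Coord m} (h : Corresponds x y) {k l : Fin (m + 1)}
    (hl : l < k) : ‖verblunsky y l‖ < 1 := by
  have := h.1 ⟨l.val, by have := Fin.lt_def.1 hl; omega⟩
  exact this

theorem Corresponds.krylov_ne_zero {m : ℕ} {x y : Coord m} (h : Corresponds x y)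
    (k : Fin (m + 1)) : krylov (verblunsky y) k k ≠ 0 :=
  krylov_diag_ne_zero _ k fun _ hl => h.norm_lt hl

/-- The moment of order k + 1 depends on α_k through a term with nonzero factor and otherwise on
earlier coefficients, so α_k can be solved for recursively. Continuity of F is not needed; this
later supplies it. -/
theorem differentiableAt_verblunsky {m : ℕ} {U : Set (Coord m)} {F : Coord m → Coord m}
    (hU : IsOpen U) (hF : ∀ x ∈ U, Corresponds x (F x)) {x : Coord m} (hx : x ∈ U)
    (k : Fin (m + 1)) : DifferentiableAt ℝ (fun y => verblunsky (F y) k) x := by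
  induction k using WellFoundedLT.induction with
  | _ k ih =>
    have hn : ∀ l < k, ‖verblunsky (F x) l‖ < 1 := fun l hl => (hF x hx).norm_lt hl
    have h1 := differentiableAt_moment_truncate (γ := fun y => verblunsky (F y)) k ih hn
    have h2 := differentiableAt_krylov (γ := fun y => verblunsky (F y)) k.val
      (fun l hl => ih l hl) (fun l hl => hn l hl) k
    have h3 : DifferentiableAt ℝ (fun y => star ((specMoment (k + 1 : ℕ) y -
        moment (truncate (verblunsky (F y)) k) (k + 1)) / krylov (verblunsky (F y)) k k ^ 2)) x := by
      have hs := (hasFDerivAt_specMoment ((k + 1 : ℕ) : ℤ) x).differentiableAt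
      have hinv := (h2.pow 2).inv (pow_ne_zero 2 ((hF x hx).krylov_ne_zero k))
      simp only [div_eq_mul_inv]
      exact ((hs.sub h1).mul hinv).star
    refine h3.congr_of_eventuallyEq ?_
    filter_upwards [hU.mem_nhds hx] with y hy
    rw [← (hF y hy).moment_eq, moment_succ_eq_truncate, add_sub_cancel_right,
      mul_div_cancel_right₀ _ (pow_ne_zero 2 ((hF y hy).krylov_ne_zero k)), star_star]

theorem isOpen_specDomain (m : ℕ) : IsOpen (specDomain m) := by
  have hc : ∀ j, Continuous fun x : Coord m => point x j := fun j => by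
    have : Continuous fun x : Coord m => theta x j := (thetaCLM j).continuous
    unfold point
    fun_prop
  have hm : ∀ j, Continuous fun x : Coord m => mass x j := fun j =>
    continuous_iff_continuousAt.2 fun x => (hasFDerivAt_mass j x).continuousAt
  have : specDomain m = (⋂ i, ⋂ j, ⋂ (_ : i ≠ j), {x | point x i ≠ point x j}) ∩
      ⋂ j, {x | 0 < mass x j} := by
    ext x
    simp only [specDomain, Set.mem_ofPred_eq, Set.mem_inter_iff, Set.mem_iInter]
    refine and_congr_left fun _ => ⟨fun h i j hij e => hij (h e), fun h i j e => ?_⟩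
    by_contra hij
    exact h i j hij e
  rw [this]
  refine IsOpen.inter (isOpen_iInter_of_finite fun i => isOpen_iInter_of_finite fun j =>
    isOpen_iInter_of_finite fun _ => isOpen_ne_fun (hc i) (hc j))
    (isOpen_iInter_of_finite fun j => isOpen_lt continuous_const (hm j))

theorem differentiableAt_fst {m : ℕ} {U : Set (Coord m)} {F : Coord m → Coord m}
    (hU : IsOpen U) (hF : ∀ x ∈ U, Corresponds x (F x)) {x : Coord m} (hx : x ∈ U) :
    DifferentiableAt ℝ (fun y => (F y).1) x := by
  rw [differentiableAt_pi]
  intro k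
  have h := differentiableAt_verblunsky hU hF hx k.castSucc
  have h1 : DifferentiableAt ℝ (fun y => (verblunsky (F y) k.castSucc).re) x :=
    Complex.reCLM.differentiableAt.comp x h
  have h2 : DifferentiableAt ℝ (fun y => (verblunsky (F y) k.castSucc).im) x :=
    Complex.imCLM.differentiableAt.comp x h
  simp only [verblunsky, Fin.snoc_castSucc] at h1 h2
  exact h1.prodMk h2

theorem differentiableAt_of_isChangeOfVariables {m : ℕ} {U : Set (Coord m)}
    {F : Coord m → Coord m} (hU : IsOpen U) (hF : IsChangeOfVariables U F) {x : Coord m}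
    (hx : x ∈ U) : DifferentiableAt ℝ F x := by
  refine (differentiableAt_fst hU hF.2 hx).prodMk (?_ : DifferentiableAt ℝ (fun y => (F y).2) x)
  have h := differentiableAt_verblunsky hU hF.2 hx (Fin.last m)
  simp only [verblunsky, Fin.snoc_last] at h
  have h1 : DifferentiableAt ℝ (fun y => Complex.exp ((F y).2 * Complex.I) *
      Complex.exp (-((F x).2 * Complex.I))) x := h.mul_const _
  -- Only e^{iφ} is known to be differentiable. Rotated so that its value at x is 1, it has a
  -- principal logarithm, which recovers φ as long as φ, by continuity, stays within π of its value
  -- at x.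
  have h2 : DifferentiableAt ℝ (fun y => (F x).2 + (Complex.log (Complex.exp ((F y).2 * Complex.I) *
      Complex.exp (-((F x).2 * Complex.I)))).im) x := by
    refine (Complex.imCLM.differentiableAt.comp x
      (((Complex.differentiableAt_log ?_).restrictScalars ℝ).comp x h1)).const_add _
    rw [← Complex.exp_add, add_neg_cancel, Complex.exp_zero]
    exact Complex.one_mem_slitPlane
  refine h2.congr_of_eventuallyEq ?_
  have hc : ContinuousAt (fun y => (F y).2) x :=
    continuous_snd.continuousAt.comp (hF.1.continuousAt (hU.mem_nhds hx))
  filter_upwards [hc.eventually (Metric.ball_mem_nhds _ Real.pi_pos)] with y hy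
  rw [Real.dist_eq, abs_lt] at hy
  rw [← Complex.exp_add, Complex.log_exp]
  · simp
  · simp; linarith
  · simp; linarith

/-! ### Existence of a continuous change of variables -/

theorem exists_corresponds {m : ℕ} {x : Coord m} (hx : x ∈ specDomain m) :
    ∃ y : Coord m, Corresponds x y ∧ y.2 = m * Real.pi - ∑ j, theta x j := by
  obtain ⟨α, h1, h2, h3⟩ := exists_hasSpectralData (theta x) (mass x) hx.1 hx.2 (sum_mass x)
  let y : Coord m := (fun k => ((α k.castSucc).re, (α k.castSucc).im),
    m * Real.pi - ∑ j, theta x j)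
  have hy : verblunsky y = α := by
    ext k
    refine Fin.lastCases ?_ (fun k => ?_) k
    -- Comparing the two values of det C shows that the last coefficient is (-1)^m e^{-i∑θ_j}, so
    -- the prescribed φ is an admissible angle.
    · have hd := (det_cmv α h1).symm.trans (det_of_hasSpectralData h3)
      rw [← Complex.exp_sum, ← Finset.sum_mul] at hd
      have hd' := congrArg star hd
      rw [star_mul', star_star, star_pow, star_neg, star_one, Complex.star_def, ← Complex.exp_conj,
        map_mul, Complex.conj_I, map_sum] at hd'
      simp only [Complex.conj_ofReal] at hd'
      simp only [verblunsky, Fin.snoc_last, y]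
      have e : Complex.exp (m * Real.pi * Complex.I) = (-1) ^ m := by
        rw [mul_assoc, Complex.exp_nat_mul, Complex.exp_pi_mul_I]
      push_cast
      rw [sub_mul, sub_eq_add_neg, Complex.exp_add, e, ← mul_neg, ← hd', ← mul_assoc, ← mul_pow]
      simp
    · simp [verblunsky, y]
  refine ⟨y, ⟨?_, ?_⟩, rfl⟩
  · rw [hy]; exact h1
  · rw [hy]; exact h3

theorem exists_isChangeOfVariables (m : ℕ) :
    ∃ F : Coord m → Coord m, IsChangeOfVariables (specDomain m) F := by
  classical
  choose! F hF hF2 using fun x : Coord m => exists_corresponds (x := x)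
  refine ⟨F, fun x hx => ContinuousAt.continuousWithinAt ?_, hF⟩
  have h1 := (differentiableAt_fst (isOpen_specDomain m) hF hx).continuousAt
  have h2 : ContinuousAt (fun y => (F y).2) x := by
    have h3 : ContinuousAt (fun y : Coord m => m * Real.pi - ∑ j, theta y j) x := by
      refine continuousAt_const.sub (tendsto_finsetSum _ fun j _ => ?_)
      exact (thetaCLM j).continuous.continuousAt
    refine h3.congr ?_
    filter_upwards [(isOpen_specDomain m).mem_nhds hx] with y hy
    rw [hF2 y hy]
  exact h1.prodMk h2

/-! ### The confluent Vandermonde determinant -/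

/-- Values and logarithmic derivatives of the powers `z^{e i}` at given points. -/
def confluent {κ ι : Type*} (e : κ → ℤ) (z : ι → ℂ) : Matrix κ (ι ⊕ ι) ℂ :=
  Matrix.of fun i => Sum.elim (fun j => e i * z j ^ e i) (fun j => z j ^ e i)

/-- The exponents `1, …, n` followed by `0, -1, …, -(n-1)`. -/
def blockExponent {n : ℕ} : Fin n ⊕ Fin n → ℤ :=
  Sum.elim (fun t => (t.val + 1 : ℕ)) (fun t => -(t.val : ℤ))

/-- On the circle, (1 - z_i/z_j)(1 - z_j/z_i) = |z_i - z_j|². -/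
theorem prod_one_sub_div {n : ℕ} (z : Fin n → ℂ) (hz : ∀ j, ‖z j‖ = 1) :
    ∏ j, ∏ i ∈ Finset.univ.erase j, (1 - z i / z j) = (‖(vandermonde z).det‖ : ℂ) ^ 2 := by
  have h1 : ∀ j : Fin n, Finset.univ.erase j = {j}ᶜ := fun j => by ext i; simp
  simp only [h1]
  rw [← Finset.prod_prod_Ioi_mul_eq_prod_prod_off_diag (fun i j => 1 - z i / z j), det_vandermonde,
    norm_prod]
  push_cast
  rw [← Finset.prod_pow]
  refine Finset.prod_congr rfl fun i _ => ?_
  rw [norm_prod]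
  push_cast
  rw [← Finset.prod_pow]
  refine Finset.prod_congr rfl fun j _ => ?_
  have h0 : ∀ k, z k ≠ 0 := fun k h => by have := hz k; rw [h] at this; simp at this
  rw [← Complex.conj_mul', map_sub, ← Complex.inv_eq_conj (hz i), ← Complex.inv_eq_conj (hz j)]
  have hi := h0 i
  have hj := h0 j
  field_simp

open Polynomial in
theorem eval_derivative_X_pow_mul (k : ℕ) (w : ℂ) :
    w * (derivative (X ^ k : ℂ[X])).eval w = k * w ^ k := by
  cases k with
  | zero => simp
  | succ k => rw [derivative_X_pow]; simp; ring

open Polynomial in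
-- Write P_t as the nodal polynomial times a monic g_t of degree t. At a node, P_t' is the nodal
-- derivative times g_t, and monic polynomials of degrees 0, 1, … have the Vandermonde determinant.
theorem det_eval_derivative_of_vanishing {n : ℕ} (z : Fin n → ℂ) (hinj : Function.Injective z)
    (P : Fin n → ℂ[X]) (hP : ∀ t, (P t).Monic) (hdeg : ∀ t, (P t).natDegree = t.val + n)
    (hroot : ∀ t j, (P t).eval (z j) = 0) :
    (Matrix.of fun t j => (derivative (P t)).eval (z j)).det =
      (∏ j, ∏ i ∈ Finset.univ.erase j, (z j - z i)) * (vandermonde z).det := by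
  have hdvd : ∀ t, Lagrange.nodal Finset.univ z ∣ P t := fun t =>
    Fintype.prod_dvd_of_coprime (pairwise_coprime_X_sub_C hinj) fun i =>
      dvd_iff_isRoot.2 (hroot t i)
  choose g hg using hdvd
  have hgm : ∀ t, (g t).Monic := fun t =>
    Lagrange.nodal_monic.of_mul_monic_left ((hg t) ▸ hP t)
  have hgd : ∀ t, (g t).natDegree = t := fun t => by
    have h := hdeg t
    rw [hg t, Lagrange.nodal_monic.natDegree_mul (hgm t), Lagrange.natDegree_nodal] at h
    simp at h
    omega
  have hval : ∀ t j, (derivative (P t)).eval (z j) =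
      (∏ i ∈ Finset.univ.erase j, (z j - z i)) * (g t).eval (z j) := by
    intro t j
    rw [hg t, derivative_mul, eval_add, eval_mul, eval_mul,
      Lagrange.eval_nodal_at_node (Finset.mem_univ j), zero_mul, add_zero,
      Lagrange.eval_nodal_derivative_eval_node_eq (Finset.mem_univ j), Lagrange.eval_nodal]
  simp only [hval]
  have hm := Matrix.det_mul_row (fun j => ∏ i ∈ Finset.univ.erase j, (z j - z i))
    (Matrix.of fun t j => (g t).eval (z j))
  simp only [of_apply] at hm
  rw [hm, det_eval_matrixOfPolynomials_eq_det_vandermonde z g hgd hgm, ← det_transpose]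
  rfl

open Polynomial in
theorem det_confluent {m : ℕ} (z : Fin (m + 1) → ℂ) (hz : ∀ j, ‖z j‖ = 1)
    (hinj : Function.Injective z) :
    (confluent blockExponent z).det = (‖(vandermonde z).det‖ : ℂ) ^ 4 * ∏ j, z j := by
  have h0 : ∀ k, z k ≠ 0 := fun k h => by have := hz k; rw [h] at this; simp at this
  set A : Matrix (Fin (m + 1)) (Fin (m + 1)) ℂ :=
    Matrix.of fun t j => ((t.val + 1 : ℕ) : ℂ) * z j ^ (t.val + 1) with hA
  set B : Matrix (Fin (m + 1)) (Fin (m + 1)) ℂ := Matrix.of fun t j => z j ^ (t.val + 1) with hB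
  set E : Matrix (Fin (m + 1)) (Fin (m + 1)) ℂ :=
    Matrix.of fun t j => -(t.val : ℂ) * z j ^ (-(t.val : ℤ)) with hE
  set D : Matrix (Fin (m + 1)) (Fin (m + 1)) ℂ := Matrix.of fun t j => z j ^ (-(t.val : ℤ)) with hD
  have hblock : confluent blockExponent z = fromBlocks A B E D := by
    ext i j
    rcases i with i | i <;> rcases j with j | j <;>
      simp only [confluent, blockExponent, of_apply, Sum.elim_inl, Sum.elim_inr,
        fromBlocks_apply₁₁, fromBlocks_apply₁₂, fromBlocks_apply₂₁, fromBlocks_apply₂₂, A, B, E, D]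
    · rw [zpow_natCast, Int.cast_natCast]
    · rw [zpow_natCast]
    · rw [Int.cast_neg, Int.cast_natCast]
  have hDdet : D.det = star (vandermonde z).det := by
    rw [← det_conjTranspose]
    congr 1
    ext t j
    simp only [D, of_apply, conjTranspose_apply, vandermonde_apply]
    rw [star_pow, Complex.star_def, ← Complex.inv_eq_conj (hz j), inv_pow, _root_.zpow_neg,
      zpow_natCast]
  have hV : (vandermonde z).det ≠ 0 := det_vandermonde_ne_zero_iff.2 hinj
  have : Invertible D := invertibleOfIsUnitDet D
    (isUnit_iff_ne_zero.2 (by rw [hDdet]; exact star_ne_zero.2 hV))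
  rw [hblock, det_fromBlocks₂₂, hDdet]
  -- Row t of β interpolates z^{t+1} at the nodes by the powers z^0, z^{-1}, …, z^{-m}.
  set β := B * ⅟D with hβ
  have hβD : β * D = B := by rw [hβ, Matrix.mul_assoc, invOf_mul_self, Matrix.mul_one]
  have hβE : ∀ t j, z j ^ (t.val + 1) = ∑ s, β t s * z j ^ (-(s.val : ℤ)) := fun t j => by
    have := congrFun (congrFun hβD t) j
    rw [Matrix.mul_apply] at this
    exact this.symm
  -- The interpolation error times z^m, so that it is a polynomial vanishing at the nodes.
  let P : Fin (m + 1) → ℂ[X] := fun t =>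
    X ^ (t.val + (m + 1)) - ∑ s : Fin (m + 1), C (β t s) * X ^ (m - s.val)
  have hpow : ∀ (s j : Fin (m + 1)), z j ^ (m - s.val) = z j ^ m * z j ^ (-(s.val : ℤ)) := by
    intro s j
    have := s.isLt
    rw [← zpow_natCast, ← zpow_natCast, ← zpow_add₀ (h0 j)]
    congr 1
    omega
  have hlow : ∀ t : Fin (m + 1),
      (∑ s : Fin (m + 1), C (β t s) * X ^ (m - s.val)).degree < ((t.val + (m + 1) : ℕ) : WithBot ℕ) := by
    intro t
    refine (degree_sum_le _ _).trans_lt ((Finset.sup_lt_iff (WithBot.bot_lt_coe _)).2 fun s _ => ?_)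
    refine (degree_C_mul_X_pow_le _ _).trans_lt ?_
    exact_mod_cast (by omega : m - s.val < t.val + (m + 1))
  have hPm : ∀ t, (P t).Monic := fun t => monic_X_pow_sub (hlow t)
  have hPd : ∀ t, (P t).natDegree = t.val + (m + 1) := fun t => by
    have : (P t).degree = ((t.val + (m + 1) : ℕ) : WithBot ℕ) := by
      rw [degree_sub_eq_left_of_degree_lt, degree_X_pow]
      rw [degree_X_pow]; exact hlow t
    exact natDegree_eq_of_degree_eq_some this
  have hroot : ∀ t j, (P t).eval (z j) = 0 := by
    intro t j
    simp only [P, eval_sub, eval_pow, eval_X, eval_finsetSum, eval_mul, eval_C, hpow]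
    have : ∑ s, β t s * (z j ^ m * z j ^ (-(s.val : ℤ))) =
        z j ^ m * ∑ s, β t s * z j ^ (-(s.val : ℤ)) := by
      rw [Finset.mul_sum]; exact Finset.sum_congr rfl fun s _ => by ring
    rw [this, ← hβE]; ring
  -- The Schur complement holds the logarithmic derivatives of z^{-m} P_t. At a zero of P_t only the
  -- term with P_t' survives.
  have hschur : ∀ t j, (A - β * E) t j =
      z j * (z j ^ m)⁻¹ * (derivative (P t)).eval (z j) := by
    intro t j
    have hzm : z j ^ m ≠ 0 := pow_ne_zero _ (h0 j)
    have e1 : z j * (derivative (P t)).eval (z j) = ((t.val + (m + 1) : ℕ) : ℂ) *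
        z j ^ (t.val + (m + 1)) - ∑ s : Fin (m + 1), β t s * (((m - s.val : ℕ) : ℂ) *
          z j ^ (m - s.val)) := by
      simp only [P, derivative_sub, derivative_sum, eval_sub, eval_finsetSum, mul_sub,
        eval_derivative_X_pow_mul, derivative_C_mul, eval_mul, eval_C, Finset.mul_sum]
      congr 1
      refine Finset.sum_congr rfl fun s _ => ?_
      rw [← eval_derivative_X_pow_mul]; ring
    have e2 : ∑ s : Fin (m + 1), β t s * (((m - s.val : ℕ) : ℂ) * z j ^ (m - s.val)) =
        z j ^ m * ((m : ℂ) * z j ^ (t.val + 1) + ∑ s, β t s * E s j) := by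
      rw [hβE t j, mul_add, Finset.mul_sum, Finset.mul_sum, Finset.mul_sum,
        ← Finset.sum_add_distrib]
      refine Finset.sum_congr rfl fun s _ => ?_
      rw [hpow, Nat.cast_sub (by have := s.isLt; omega)]
      simp only [E, of_apply]
      ring
    rw [Matrix.sub_apply, Matrix.mul_apply, mul_right_comm, e1, e2]
    simp only [A, of_apply]
    field_simp
    push_cast
    ring
  have hS : A - β * E = Matrix.of fun t j => (z j * (z j ^ m)⁻¹) *
      (Matrix.of fun t j => (derivative (P t)).eval (z j) : Matrix _ _ ℂ) t j := by
    ext t j; rw [hschur]; rfl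
  rw [hS, det_mul_row, det_eval_derivative_of_vanishing z hinj P hPm hPd hroot]
  have hprod : (∏ j, z j * (z j ^ m)⁻¹) * ∏ j, ∏ i ∈ Finset.univ.erase j, (z j - z i) =
      (∏ j, z j) * (‖(vandermonde z).det‖ : ℂ) ^ 2 := by
    rw [← prod_one_sub_div z hz, ← Finset.prod_mul_distrib, ← Finset.prod_mul_distrib]
    refine Finset.prod_congr rfl fun j _ => ?_
    have hc : (z j ^ m)⁻¹ = ∏ i ∈ Finset.univ.erase j, (z j)⁻¹ := by
      rw [Finset.prod_const, Finset.card_erase_of_mem (Finset.mem_univ j)]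
      simp
    rw [hc, mul_assoc, ← Finset.prod_mul_distrib]
    congr 1
    refine Finset.prod_congr rfl fun i _ => ?_
    have := h0 j
    field_simp
  have hn : star (vandermonde z).det * (vandermonde z).det = (‖(vandermonde z).det‖ : ℂ) ^ 2 :=
    Complex.conj_mul' _
  calc _ = (star (vandermonde z).det * (vandermonde z).det) *
        ((∏ j, z j * (z j ^ m)⁻¹) * ∏ j, ∏ i ∈ Finset.univ.erase j, (z j - z i)) := by ring
    _ = _ := by rw [hn, hprod]; ring

/-! ### Jacobian of the moments in Verblunsky coordinates -/

/-- Allows the interleaved order u_0, v_0, u_1, v_1, … on an index type that is a sum. -/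
theorem det_of_lower_triangular_of_injective {ι R : Type*} [Fintype ι] [DecidableEq ι] [CommRing R]
    (A : Matrix ι ι R) (b : ι → ℕ) (hb : Function.Injective b)
    (h : ∀ i j, b i < b j → A i j = 0) : A.det = ∏ i, A i i := by
  let o : LinearOrder ι := LinearOrder.lift' b hb
  have key := @Matrix.det_of_isLowerTriangular ι R _ _ _ o A (fun i j hij => h i j hij)
  convert key

/-- Coordinates on `Coord m`: first `θ₁, …, θ_n` (or `u₀, …, u_{n-2}, φ`), then
`μ₁, …, μ_{n-1}` (or `v₀, …, v_{n-2}`). -/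
def coordEquiv (m : ℕ) : Coord m ≃ₗ[ℝ] (Fin (m + 1) ⊕ Fin m → ℝ) where
  toFun x := Sum.elim (theta x) fun k => (x.1 k).2
  invFun f := (fun k => (f (Sum.inl k.castSucc), f (Sum.inr k)), f (Sum.inl (Fin.last m)))
  map_add' x y := by
    ext (j | k)
    · exact (thetaCLM j).map_add x y
    · rfl
  map_smul' c x := by
    ext (j | k)
    · exact (thetaCLM j).map_smul c x
    · rfl
  left_inv x := by simp [theta]
  right_inv f := by
    ext (j | k)
    · refine Fin.lastCases ?_ (fun k => ?_) j <;> simp [theta]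
    · rfl

/-- The basis of `Coord m` belonging to `coordEquiv`. -/
def coordBasis (m : ℕ) : Module.Basis (Fin (m + 1) ⊕ Fin m) ℝ (Coord m) :=
  Module.Basis.ofEquivFun (coordEquiv m)

theorem coordBasis_eq (m : ℕ) (a : Fin (m + 1) ⊕ Fin m) :
    coordBasis m a = (coordEquiv m).symm (Pi.single a 1) := by
  rw [coordBasis, Module.Basis.coe_ofEquivFun]

theorem theta_coordBasis {m : ℕ} (a : Fin (m + 1) ⊕ Fin m) (j : Fin (m + 1)) :
    theta (coordBasis m a) j = (Pi.single a 1 : Fin (m + 1) ⊕ Fin m → ℝ) (Sum.inl j) := by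
  have : (coordEquiv m) (coordBasis m a) (Sum.inl j) = theta (coordBasis m a) j := rfl
  rw [← this, coordBasis_eq, LinearEquiv.apply_symm_apply]

theorem coordBasis_fst_fst {m : ℕ} (a : Fin (m + 1) ⊕ Fin m) (k : Fin m) :
    ((coordBasis m a).1 k).1 =
      (Pi.single a 1 : Fin (m + 1) ⊕ Fin m → ℝ) (Sum.inl k.castSucc) := by
  rw [coordBasis_eq]; rfl

theorem coordBasis_fst_snd {m : ℕ} (a : Fin (m + 1) ⊕ Fin m) (k : Fin m) :
    ((coordBasis m a).1 k).2 = (Pi.single a 1 : Fin (m + 1) ⊕ Fin m → ℝ) (Sum.inr k) := by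
  rw [coordBasis_eq]; rfl

theorem coordBasis_snd {m : ℕ} (a : Fin (m + 1) ⊕ Fin m) :
    (coordBasis m a).2 = (Pi.single a 1 : Fin (m + 1) ⊕ Fin m → ℝ) (Sum.inl (Fin.last m)) := by
  rw [coordBasis_eq]; rfl

/-- The index of the Verblunsky coefficient in which a coordinate occurs. -/
def coordIndex {m : ℕ} : Fin (m + 1) ⊕ Fin m → Fin (m + 1) := Sum.elim id Fin.castSucc

/-- The derivative of a Verblunsky coefficient in the coordinate that it contains. -/
def coordDeriv {m : ℕ} (y : Coord m) : Fin (m + 1) ⊕ Fin m → ℂ :=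
  Sum.elim (Fin.snoc (fun _ => 1) (Complex.I * verblunsky y (Fin.last m))) fun _ => Complex.I

theorem verblunsky_castSucc {m : ℕ} (y : Coord m) (k : Fin m) :
    verblunsky y k.castSucc = ⟨(y.1 k).1, (y.1 k).2⟩ := by simp [verblunsky]

theorem verblunsky_last {m : ℕ} (y : Coord m) :
    verblunsky y (Fin.last m) = Complex.exp (y.2 * Complex.I) := by simp [verblunsky]

theorem verblunsky_add_smul_of_ne {m : ℕ} (y : Coord m) (a : Fin (m + 1) ⊕ Fin m) (s : ℝ)
    (j : Fin (m + 1)) (h : coordIndex a ≠ j) :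
    verblunsky (y + s • coordBasis m a) j = verblunsky y j := by
  revert h
  refine Fin.lastCases ?_ (fun k => ?_) j
  · intro h
    have ha : Sum.inl (Fin.last m) ≠ a := fun e => h (by rw [← e]; rfl)
    rw [verblunsky_last, verblunsky_last]
    simp [coordBasis_snd, ha]
  · intro h
    have ha : Sum.inl k.castSucc ≠ a := fun e => h (by rw [← e]; rfl)
    have ha' : Sum.inr k ≠ a := fun e => h (by rw [← e]; rfl)
    rw [verblunsky_castSucc, verblunsky_castSucc]
    simp [coordBasis_fst_fst, coordBasis_fst_snd, ha, ha']

theorem hasDerivAt_verblunsky_add_smul {m : ℕ} (y : Coord m) (a : Fin (m + 1) ⊕ Fin m) :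
    HasDerivAt (fun s : ℝ => verblunsky (y + s • coordBasis m a) (coordIndex a))
      (coordDeriv y a) 0 := by
  have hid : HasDerivAt (fun s : ℝ => (s : ℂ)) 1 0 := Complex.ofRealCLM.hasDerivAt
  rcases a with j | k
  · refine Fin.lastCases ?_ (fun k => ?_) j
    · have e : ∀ s : ℝ, verblunsky (y + s • coordBasis m (Sum.inl (Fin.last m))) (Fin.last m) =
          Complex.exp ((y.2 + s) * Complex.I) := fun s => by
        rw [verblunsky_last]; simp [coordBasis_snd]
      change HasDerivAt (fun s : ℝ => verblunsky (y + s • coordBasis m _) (Fin.last m)) _ 0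
      simp only [e]
      have h := ((hid.const_add (y.2 : ℂ)).mul_const Complex.I).cexp
      simpa [coordDeriv, verblunsky_last, mul_comm] using h
    · have e : ∀ s : ℝ, verblunsky (y + s • coordBasis m (Sum.inl k.castSucc)) k.castSucc =
          verblunsky y k.castSucc + s := fun s => by
        rw [verblunsky_castSucc, verblunsky_castSucc]
        apply Complex.ext <;> simp [coordBasis_fst_fst, coordBasis_fst_snd]
      change HasDerivAt (fun s : ℝ => verblunsky (y + s • coordBasis m _) k.castSucc) _ 0
      simp only [e]
      simpa [coordDeriv] using hid.const_add (verblunsky y k.castSucc)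
  · have e : ∀ s : ℝ, verblunsky (y + s • coordBasis m (Sum.inr k)) k.castSucc =
        verblunsky y k.castSucc + s * Complex.I := fun s => by
      rw [verblunsky_castSucc, verblunsky_castSucc]
      apply Complex.ext <;> simp [coordBasis_fst_fst, coordBasis_fst_snd]
    change HasDerivAt (fun s : ℝ => verblunsky (y + s • coordBasis m _) k.castSucc) _ 0
    simp only [e]
    simpa [coordDeriv] using (hid.mul_const Complex.I).const_add (verblunsky y k.castSucc)

theorem differentiable_verblunsky {m : ℕ} (j : Fin (m + 1)) :
    Differentiable ℝ fun y : Coord m => verblunsky y j := by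
  refine Fin.lastCases ?_ (fun k => ?_) j
  · simp only [verblunsky_last]
    have h : Differentiable ℝ fun y : Coord m => (y.2 : ℂ) :=
      Complex.ofRealCLM.differentiable.comp differentiable_snd
    fun_prop
  · have e : ∀ y : Coord m, verblunsky y k.castSucc =
        ((y.1 k).1 : ℂ) + ((y.1 k).2 : ℂ) * Complex.I := fun y => by
      rw [verblunsky_castSucc]; apply Complex.ext <;> simp
    simp only [e]
    have h0 : Differentiable ℝ fun y : Coord m => y.1 k :=
      differentiable_pi.1 differentiable_fst k
    have h1 : Differentiable ℝ fun y : Coord m => ((y.1 k).1 : ℂ) :=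
      Complex.ofRealCLM.differentiable.comp h0.fst
    have h2 : Differentiable ℝ fun y : Coord m => ((y.1 k).2 : ℂ) :=
      Complex.ofRealCLM.differentiable.comp h0.snd
    fun_prop

/-- The moment of order `k + 1` as a function of the Verblunsky coordinates. -/
def coordMoment {m : ℕ} (k : Fin (m + 1)) (y : Coord m) : ℂ := moment (verblunsky y) (k + 1)

theorem differentiableAt_coordMoment {m : ℕ} {y : Coord m}
    (hy : ∀ k : Fin m, ‖verblunsky y k.castSucc‖ < 1) (k : Fin (m + 1)) :
    DifferentiableAt ℝ (coordMoment k) y :=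
  differentiableAt_moment k (fun l _ => differentiable_verblunsky l y) fun l hl =>
    hy ⟨l.val, by have := Fin.lt_def.1 hl; omega⟩

/-- Along this coordinate line no coefficient below k moves, so `moment_succ_sub` gives the
increment of the moment exactly. -/
theorem fderiv_coordMoment {m : ℕ} {y : Coord m}
    (hy : ∀ k : Fin m, ‖verblunsky y k.castSucc‖ < 1) (k : Fin (m + 1))
    (a : Fin (m + 1) ⊕ Fin m) (hk : k ≤ coordIndex a) :
    fderiv ℝ (coordMoment k) y (coordBasis m a) =
      if coordIndex a = k then star (coordDeriv y a) * krylov (verblunsky y) k k ^ 2 else 0 := by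
  have hline : HasDerivAt (fun s : ℝ => y + s • coordBasis m a) (coordBasis m a) 0 := by
    simpa using ((hasDerivAt_id (0 : ℝ)).smul_const (coordBasis m a)).const_add y
  have h1 : HasDerivAt (fun s : ℝ => coordMoment k (y + s • coordBasis m a))
      (fderiv ℝ (coordMoment k) y (coordBasis m a)) 0 := by
    have hd : HasFDerivAt (coordMoment k) (fderiv ℝ (coordMoment k) y)
        (y + (0 : ℝ) • coordBasis m a) := by
      simpa using (differentiableAt_coordMoment hy k).hasFDerivAt
    exact hd.comp_hasDerivAt (0 : ℝ) hline
  have e : ∀ s : ℝ, coordMoment k (y + s • coordBasis m a) = coordMoment k y +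
      star (verblunsky (y + s • coordBasis m a) k - verblunsky y k) *
        krylov (verblunsky y) k k ^ 2 := by
    intro s
    have h := moment_succ_sub (verblunsky y) (verblunsky (y + s • coordBasis m a)) k
      fun l hl => (verblunsky_add_smul_of_ne y a s l (hl.trans_le hk).ne').symm
    simp only [coordMoment]
    rw [star_sub] at h ⊢
    linear_combination -h
  rw [funext e] at h1
  refine h1.unique ?_
  split_ifs with hak
  · subst hak
    exact (((hasDerivAt_verblunsky_add_smul y a).sub_const _).star.mul_const _).const_add _
  · simp only [verblunsky_add_smul_of_ne y a _ k hak, sub_self, star_zero, zero_mul, add_zero]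
    exact hasDerivAt_const _ _

/-- The derivatives of the moments of orders `1, …, n` and `-1, …, -(n-1)` with respect to the
Verblunsky coordinates. -/
def momentJacobian {m : ℕ} (y : Coord m) :
    Matrix (Fin (m + 1) ⊕ Fin m) (Fin (m + 1) ⊕ Fin m) ℂ :=
  Matrix.of fun i a => Sum.elim (fun k => fderiv ℝ (coordMoment k) y (coordBasis m a))
    (fun k => star (fderiv ℝ (coordMoment k.castSucc) y (coordBasis m a))) i

theorem star_krylov_diag {n : ℕ} [NeZero n] (α : Fin n → ℂ) (i : Fin n) :
    star (krylov α i i) = krylov α i i := by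
  rw [krylov_diag]; exact Complex.conj_ofReal _

theorem det_momentJacobian {m : ℕ} {y : Coord m}
    (hy : ∀ k : Fin m, ‖verblunsky y k.castSucc‖ < 1) :
    (momentJacobian y).det =
      (∏ k : Fin m, krylov (verblunsky y) k.castSucc k.castSucc ^ 2) ^ 2 *
        (2 * Complex.I) ^ m * (-Complex.I * star (verblunsky y (Fin.last m)) *
          krylov (verblunsky y) (Fin.last m) (Fin.last m) ^ 2) := by
  -- Adding i times the u_k column to the v_k column turns the diagonal block [K², -iK²; K², iK²]
  -- into [K², 0; K², 2iK²].
  let U : Matrix (Fin (m + 1) ⊕ Fin m) (Fin (m + 1) ⊕ Fin m) ℂ :=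
    fromBlocks 1 (Matrix.of fun j k => if j = k.castSucc then Complex.I else 0) 0 1
  have hU : U.det = 1 := by simp [U]
  have hl : ∀ i j, (momentJacobian y * U) i (Sum.inl j) = momentJacobian y i (Sum.inl j) := by
    intro i j
    rw [Matrix.mul_apply, Fintype.sum_sum_type]
    simp [U, Matrix.one_apply]
  have hr : ∀ i k, (momentJacobian y * U) i (Sum.inr k) =
      momentJacobian y i (Sum.inr k) + Complex.I * momentJacobian y i (Sum.inl k.castSucc) := by
    intro i k
    rw [Matrix.mul_apply, Fintype.sum_sum_type]
    simp [U, Matrix.one_apply]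
    ring
  have hlow : ∀ (k : Fin (m + 1)) (a : Fin (m + 1) ⊕ Fin m), k < coordIndex a →
      fderiv ℝ (coordMoment k) y (coordBasis m a) = 0 := fun k a h => by
    rw [fderiv_coordMoment hy k a h.le, if_neg h.ne']
  have hdiag : ∀ a : Fin (m + 1) ⊕ Fin m,
      fderiv ℝ (coordMoment (coordIndex a)) y (coordBasis m a) =
        star (coordDeriv y a) * krylov (verblunsky y) (coordIndex a) (coordIndex a) ^ 2 :=
    fun a => by rw [fderiv_coordMoment hy _ a le_rfl, if_pos rfl]
  have hu : ∀ k : Fin m, fderiv ℝ (coordMoment k.castSucc) y (coordBasis m (Sum.inl k.castSucc)) =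
      krylov (verblunsky y) k.castSucc k.castSucc ^ 2 := fun k => by
    have := hdiag (Sum.inl k.castSucc)
    simpa [coordIndex, coordDeriv] using this
  have hv : ∀ k : Fin m, fderiv ℝ (coordMoment k.castSucc) y (coordBasis m (Sum.inr k)) =
      -Complex.I * krylov (verblunsky y) k.castSucc k.castSucc ^ 2 := fun k => by
    have := hdiag (Sum.inr k)
    simpa [coordIndex, coordDeriv] using this
  have hphi : fderiv ℝ (coordMoment (Fin.last m)) y (coordBasis m (Sum.inl (Fin.last m))) =
      -Complex.I * star (verblunsky y (Fin.last m)) *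
          krylov (verblunsky y) (Fin.last m) (Fin.last m) ^ 2 := by
    have := hdiag (Sum.inl (Fin.last m))
    simpa [coordIndex, coordDeriv] using this
  have htri := det_of_lower_triangular_of_injective (momentJacobian y * U)
    (Sum.elim (fun k : Fin (m + 1) => 2 * k.val) fun k : Fin m => 2 * k.val + 1) (by
      rintro (i | i) (j | j) h <;> simp only [Sum.elim_inl, Sum.elim_inr] at h
      · rw [Fin.ext (by omega : i.val = j.val)]
      · omega
      · omega
      · rw [Fin.ext (by omega : i.val = j.val)]) (by
      rintro (i | i) (j | j) h <;> simp only [Sum.elim_inl, Sum.elim_inr] at h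
      · rw [hl]
        exact hlow i (Sum.inl j) (Fin.lt_def.2 (by simp [coordIndex]; omega))
      · rw [hr]
        change fderiv ℝ (coordMoment i) y _ + Complex.I * fderiv ℝ (coordMoment i) y _ = 0
        rcases Nat.lt_or_ge i.val j.val with hij | hij
        · rw [hlow i (Sum.inr j) (Fin.lt_def.2 hij), hlow i (Sum.inl j.castSucc) (Fin.lt_def.2 hij)]
          simp
        -- The entry above the diagonal inside a two-by-two block, which the column operation was
        -- chosen to cancel.
        · obtain rfl : i = j.castSucc := Fin.ext (by simp; omega)
          rw [hu, hv]; ring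
      · rw [hl]
        change star (fderiv ℝ (coordMoment i.castSucc) y _) = 0
        rw [hlow i.castSucc (Sum.inl j) (Fin.lt_def.2 (by simp [coordIndex]; omega)), star_zero]
      · rw [hr]
        change star (fderiv ℝ (coordMoment i.castSucc) y _) +
          Complex.I * star (fderiv ℝ (coordMoment i.castSucc) y _) = 0
        have hij : i.castSucc.val < j.val := by simp; omega
        rw [hlow i.castSucc (Sum.inr j) (Fin.lt_def.2 hij),
          hlow i.castSucc (Sum.inl j.castSucc) (Fin.lt_def.2 hij)]
        simp)
  rw [det_mul, hU, mul_one] at htri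
  rw [htri, Fintype.prod_sum_type, Fin.prod_univ_castSucc]
  have e1 : ∀ k : Fin m, (momentJacobian y * U) (Sum.inl k.castSucc) (Sum.inl k.castSucc) =
      krylov (verblunsky y) k.castSucc k.castSucc ^ 2 := fun k => by rw [hl, ← hu]; rfl
  have e2 : (momentJacobian y * U) (Sum.inl (Fin.last m)) (Sum.inl (Fin.last m)) =
      -Complex.I * star (verblunsky y (Fin.last m)) *
          krylov (verblunsky y) (Fin.last m) (Fin.last m) ^ 2 := by rw [hl, ← hphi]; rfl
  have e3 : ∀ k : Fin m, (momentJacobian y * U) (Sum.inr k) (Sum.inr k) =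
      2 * Complex.I * krylov (verblunsky y) k.castSucc k.castSucc ^ 2 := fun k => by
    rw [hr]
    change star (fderiv ℝ (coordMoment k.castSucc) y _) +
          Complex.I * star (fderiv ℝ (coordMoment k.castSucc) y _) = _
    rw [hu, hv, star_mul', star_pow, star_krylov_diag, star_neg, Complex.star_def, Complex.conj_I]
    ring
  simp only [e1, e2, e3, Finset.prod_mul_distrib, Finset.prod_const, Finset.card_univ,
    Fintype.card_fin]
  ring

/-! ### Jacobian of the moments in angles and masses -/

/-- The exponents `1, …, n` followed by `-1, …, -(n-1)`. -/
def momentExponent {m : ℕ} : Fin (m + 1) ⊕ Fin m → ℤ :=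
  Sum.elim (fun k => (k.val + 1 : ℕ)) fun k => -((k.val + 1 : ℕ) : ℤ)

/-- The derivatives of the moments of orders `1, …, n` and `-1, …, -(n-1)` with respect to the
angles and masses. -/
def specJacobian {m : ℕ} (x : Coord m) :
    Matrix (Fin (m + 1) ⊕ Fin m) (Fin (m + 1) ⊕ Fin m) ℂ :=
  Matrix.of fun i a => specMomentDeriv (momentExponent i) x (coordBasis m a)

theorem specMomentDeriv_apply {m : ℕ} (k : ℤ) (x d : Coord m) :
    specMomentDeriv k x d = ∑ j, (point x j ^ k * (massCLM j d : ℂ) +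
      (mass x j : ℂ) * (k * Complex.I * point x j ^ k) * (theta d j : ℂ)) := by
  simp only [specMomentDeriv, FunLike.coe_sum, Finset.sum_apply]
  rfl

theorem specMomentDeriv_inl {m : ℕ} (k : ℤ) (x : Coord m) (j : Fin (m + 1)) :
    specMomentDeriv k x (coordBasis m (Sum.inl j)) =
      (Complex.I * mass x j) * (k * point x j ^ k) := by
  rw [specMomentDeriv_apply]
  have hm : ∀ i, massCLM i (coordBasis m (Sum.inl j)) = 0 := by
    intro i
    refine Fin.lastCases ?_ (fun k => ?_) i
    · rw [massCLM_last]; simp [coordBasis_fst_snd]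
    · rw [massCLM_castSucc]; simp [coordBasis_fst_snd]
  simp only [hm, theta_coordBasis]
  rw [Fintype.sum_eq_single j fun i hi => by simp [hi]]
  simp; ring

theorem specMomentDeriv_inr {m : ℕ} (k : ℤ) (x : Coord m) (l : Fin m) :
    specMomentDeriv k x (coordBasis m (Sum.inr l)) =
      point x l.castSucc ^ k - point x (Fin.last m) ^ k := by
  rw [specMomentDeriv_apply, Fin.sum_univ_castSucc]
  simp only [massCLM_last, massCLM_castSucc, theta_coordBasis, coordBasis_fst_snd]
  have hsum : ∑ i, (Pi.single (Sum.inr l) 1 : Fin (m + 1) ⊕ Fin m → ℝ) (Sum.inr i) = 1 := by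
    rw [Fintype.sum_eq_single l fun i hi => by simp [hi]]
    simp
  rw [hsum, Fintype.sum_eq_single l fun i hi => by simp [hi]]
  simp
  ring

/-- `momentExponent` with the exponent `0` appended. -/
def fullExponent {m : ℕ} : Fin (m + 1) ⊕ Fin (m + 1) → ℤ :=
  Sum.elim (fun k => (k.val + 1 : ℕ)) (Fin.snoc (fun k => -((k.val + 1 : ℕ) : ℤ)) 0)

/-- Moving the exponent 0 from the front of the second group to its end is a cycle of length m + 1,
of sign (-1)^m. -/
theorem det_confluent_fullExponent {m : ℕ} (z : Fin (m + 1) → ℂ) (hz : ∀ j, ‖z j‖ = 1)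
    (hinj : Function.Injective z) :
    (confluent fullExponent z).det =
      (-1) ^ m * ((‖(vandermonde z).det‖ : ℂ) ^ 4 * ∏ j, z j) := by
  have h : confluent fullExponent z = (confluent blockExponent z).submatrix
      (Equiv.Perm.sumCongr 1 (finRotate (m + 1))) id := by
    have he : ∀ i : Fin (m + 1) ⊕ Fin (m + 1), fullExponent i =
        blockExponent (Equiv.Perm.sumCongr 1 (finRotate (m + 1)) i) := by
      rintro (i | i)
      · rfl
      · refine Fin.lastCases ?_ (fun k => ?_) i
        · simp [fullExponent, blockExponent]
        · simp [fullExponent, blockExponent]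
    ext i j
    simp [confluent, he]
  rw [h, det_permute, det_confluent z hz hinj, Equiv.Perm.sign_sumCongr, sign_finRotate]
  simp

theorem det_specJacobian {m : ℕ} {x : Coord m} (hx : x ∈ specDomain m) :
    (specJacobian x).det = Complex.I ^ (m + 1) * (∏ j, (mass x j : ℂ)) *
      ((-1) ^ m * ((‖(vandermonde (point x)).det‖ : ℂ) ^ 4 * ∏ j, point x j)) := by
  set K := confluent fullExponent (point x)
  let K₁ : Matrix (Fin (m + 1) ⊕ Fin (m + 1)) (Fin (m + 1) ⊕ Fin (m + 1)) ℂ :=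
    Matrix.of fun i a => (Sum.elim (fun j => Complex.I * mass x j) (fun _ => 1) :
      Fin (m + 1) ⊕ Fin (m + 1) → ℂ) a * K i a
  have hK₁ : K₁.det = Complex.I ^ (m + 1) * (∏ j, (mass x j : ℂ)) * K.det := by
    rw [det_mul_row, Fintype.prod_sum_type]
    simp [Finset.prod_mul_distrib]
  -- Subtract the last mass column from the other mass columns, reflecting μ_n = 1 - ∑ μ_k.
  let c : Fin (m + 1) ⊕ Fin (m + 1) → ℂ := Sum.elim (fun _ => 0) (Fin.snoc (fun _ => -1) 0)
  let K₂ : Matrix (Fin (m + 1) ⊕ Fin (m + 1)) (Fin (m + 1) ⊕ Fin (m + 1)) ℂ :=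
    Matrix.of fun i a => K₁ i a + c a * K₁ i (Sum.inr (Fin.last m))
  have hK₂ : K₂.det = K₁.det := by
    rw [← det_transpose K₂, ← det_transpose K₁]
    exact det_eq_of_forall_row_eq_smul_add_const c (Sum.inr (Fin.last m)) (by simp [c])
      fun a i => rfl
  let ε : (Fin (m + 1) ⊕ Fin m) ⊕ Fin 1 ≃ Fin (m + 1) ⊕ Fin (m + 1) :=
    (Equiv.sumAssoc _ _ _).trans (Equiv.sumCongr (Equiv.refl _) finSumFinEquiv)
  have hε1 : ∀ j, ε (Sum.inl (Sum.inl j)) = Sum.inl j := fun j => rfl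
  have hε2 : ∀ k, ε (Sum.inl (Sum.inr k)) = Sum.inr k.castSucc := fun k => rfl
  have hε3 : ∀ i, ε (Sum.inr i) = Sum.inr (Fin.last m) := fun i => by
    rw [Subsingleton.elim i 0]; rfl
  have hexp : ∀ i, fullExponent (ε (Sum.inl i)) = momentExponent i := by
    rintro (i | i)
    · rfl
    · simp [hε2, fullExponent, momentExponent]
  have hexp0 : fullExponent (Sum.inr (Fin.last m)) = 0 := by simp [fullExponent]
  -- The row of exponent 0 had 0 in the angle columns and 1 in the mass columns. After the
  -- subtraction only its last entry remains, so the last row and column split off.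
  have hb : K₂.submatrix ε ε = fromBlocks (specJacobian x)
      (Matrix.of fun i _ => K₂ (ε (Sum.inl i)) (Sum.inr (Fin.last m))) 0 1 := by
    ext i a
    rcases i with i | i
    · rcases a with (j | k) | a
      · rw [submatrix_apply, hε1, fromBlocks_apply₁₁, specJacobian, of_apply, specMomentDeriv_inl,
          ← hexp]
        simp [K₂, K₁, K, c, confluent]
      · rw [submatrix_apply, hε2, fromBlocks_apply₁₁, specJacobian, of_apply, specMomentDeriv_inr,
          ← hexp]
        simp [K₂, K₁, K, c, confluent, sub_eq_add_neg]
      · rw [submatrix_apply, hε3]; rfl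
    · rcases a with (j | k) | a
      · rw [submatrix_apply, hε1, hε3]
        simp [K₂, K₁, K, c, confluent, hexp0]
      · rw [submatrix_apply, hε2, hε3]
        simp [K₂, K₁, K, c, confluent, hexp0]
      · rw [submatrix_apply, hε3, hε3, Subsingleton.elim i a]
        simp [K₂, K₁, K, c, confluent, hexp0]
  have hdet : (specJacobian x).det = K₂.det := by
    rw [← det_submatrix_equiv_self ε K₂, hb, det_fromBlocks_zero₂₁, det_one, mul_one]
  rw [hdet, hK₂, hK₁, det_confluent_fullExponent (point x) (norm_point x) hx.1]

theorem specMoment_neg {m : ℕ} (k : ℤ) (x : Coord m) :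
    specMoment (-k) x = star (specMoment k x) := by
  rw [specMoment, specMoment, star_sum]
  refine Finset.sum_congr rfl fun j _ => ?_
  rw [star_mul', Complex.star_def, Complex.conj_ofReal, map_zpow₀,
    ← Complex.inv_eq_conj (norm_point x j), _root_.inv_zpow, _root_.zpow_neg]

theorem specMomentDeriv_neg {m : ℕ} (k : ℤ) (x d : Coord m) :
    specMomentDeriv (-k) x d = star (specMomentDeriv k x d) := by
  have h1 := hasFDerivAt_specMoment (-k) x
  rw [funext (specMoment_neg k)] at h1
  have h2 := (Complex.conjCLE.toContinuousLinearMap.hasFDerivAt).comp x (hasFDerivAt_specMoment k x)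
  exact congrArg (fun f : Coord m →L[ℝ] ℂ => f d) (h1.unique h2)

/-! ### Chain rule and conclusion -/

/-- Differentiates c_k(x) = c_k(F x). The rows of negative order follow by conjugation, since the
matrix of the derivative of F is real. -/
theorem specJacobian_eq_mul {m : ℕ} {U : Set (Coord m)} {F : Coord m → Coord m} (hU : IsOpen U)
    (hF : IsChangeOfVariables U F) {x : Coord m} (hx : x ∈ U) :
    specJacobian x = momentJacobian (F x) *
      (LinearMap.toMatrix (coordBasis m) (coordBasis m)
        (fderiv ℝ F x : Coord m →ₗ[ℝ] Coord m)).map Complex.ofReal := by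
  have hd := (differentiableAt_of_isChangeOfVariables hU hF hx).hasFDerivAt
  have hrow : ∀ (k : Fin (m + 1)) (d : Coord m), specMomentDeriv ((k.val + 1 : ℕ) : ℤ) x d =
      fderiv ℝ (coordMoment k) (F x) (fderiv ℝ F x d) := by
    intro k d
    have h1 := ((differentiableAt_coordMoment (hF.2 x hx).1 k).hasFDerivAt).comp x hd
    have h2 : HasFDerivAt (coordMoment k ∘ F) (specMomentDeriv ((k.val + 1 : ℕ) : ℤ) x) x := by
      refine (hasFDerivAt_specMoment _ x).congr_of_eventuallyEq ?_
      filter_upwards [hU.mem_nhds hx] with y hy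
      exact (hF.2 y hy).moment_eq _
    exact congrArg (fun f : Coord m →L[ℝ] ℂ => f d) (h2.unique h1)
  have hexpand : ∀ (f : Coord m →L[ℝ] ℂ) (a : Fin (m + 1) ⊕ Fin m),
      f (fderiv ℝ F x (coordBasis m a)) = ∑ b, f (coordBasis m b) *
        ((LinearMap.toMatrix (coordBasis m) (coordBasis m)
          (fderiv ℝ F x : Coord m →ₗ[ℝ] Coord m) b a : ℝ) : ℂ) := by
    intro f a
    conv_lhs => rw [← (coordBasis m).sum_repr (fderiv ℝ F x (coordBasis m a))]
    rw [map_sum]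
    refine Finset.sum_congr rfl fun b _ => ?_
    rw [map_smul, LinearMap.toMatrix_apply, Complex.real_smul, mul_comm]
    rfl
  ext i a
  rw [Matrix.mul_apply]
  rcases i with k | k
  · change specMomentDeriv ((k.val + 1 : ℕ) : ℤ) x (coordBasis m a) = _
    rw [hrow, hexpand]
    rfl
  · change specMomentDeriv (-((k.castSucc.val + 1 : ℕ) : ℤ)) x (coordBasis m a) = _
    rw [specMomentDeriv_neg, hrow, hexpand, star_sum]
    refine Finset.sum_congr rfl fun b _ => ?_
    rw [star_mul', Complex.star_def, Complex.conj_ofReal]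
    rfl

theorem det_fderiv_changeOfVariables {m : ℕ} {U : Set (Coord m)} {F : Coord m → Coord m}
    (hU : IsOpen U) (hUs : U ⊆ specDomain m) (hF : IsChangeOfVariables U F) {x : Coord m}
    (hx : x ∈ U) :
    (fderiv ℝ F x).det = -((2 : ℝ) ^ (1 - ((m + 1 : ℕ) : ℤ)) *
      ((∏ k : Fin m, rho (verblunsky (F x) k.castSucc) ^ 2) / ∏ j : Fin (m + 1), mass x j)) := by
  have hc := hF.2 x hx
  set α := verblunsky (F x) with hα
  set δ := (fderiv ℝ F x).det with hδ
  have hmul := congrArg Matrix.det (specJacobian_eq_mul hU hF hx)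
  have hJ : ((LinearMap.toMatrix (coordBasis m) (coordBasis m)
        (fderiv ℝ F x : Coord m →ₗ[ℝ] Coord m)).map Complex.ofReal).det = (δ : ℂ) := by
    have h1 := RingHom.map_det Complex.ofRealHom (LinearMap.toMatrix (coordBasis m) (coordBasis m)
        (fderiv ℝ F x : Coord m →ₗ[ℝ] Coord m))
    rw [LinearMap.det_toMatrix] at h1
    exact h1.symm
  rw [det_mul, hJ, det_specJacobian (hUs hx), det_momentJacobian hc.1, ← hα] at hmul
  have hz : ∏ j, point x j = (-1) ^ m * star (α (Fin.last m)) := by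
    rw [← det_cmv α hc.1]; exact (det_of_hasSpectralData hc.2).symm
  have hprod : (∏ k : Fin m, krylov α k.castSucc k.castSucc ^ 2) *
      krylov α (Fin.last m) (Fin.last m) ^ 2 =
      (∏ j, (mass x j : ℂ)) * (‖(vandermonde (point x)).det‖ : ℂ) ^ 2 := by
    have h := prod_krylov_diag hc.2
    have hk : ∀ i : Fin (m + 1), ((‖krylov α i i‖ : ℝ) : ℂ) ^ 2 = krylov α i i ^ 2 := fun i => by
      rw [← Complex.conj_mul']
      change star (krylov α i i) * _ = _
      rw [star_krylov_diag, pow_two]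
    have h' := congrArg Complex.ofReal h
    push_cast at h'
    rw [← hα] at h'
    simp only [hk] at h'
    rw [Fin.prod_univ_castSucc] at h'
    exact h'
  have hlast : krylov α (Fin.last m) (Fin.last m) ^ 2 =
      ((∏ k : Fin m, rho (α k.castSucc) ^ 2 : ℝ) : ℂ) := by
    rw [krylov_diag, Finset.prod_pow]
    push_cast
    congr 1
    rw [Finset.prod_filter, Fin.prod_univ_castSucc]
    simp [Fin.castSucc_lt_last]
  have hmass : ∏ j, mass x j ≠ 0 := Finset.prod_ne_zero_iff.2 fun j _ => ((hUs hx).2 j).ne'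
  have hmassC : ∏ j, (mass x j : ℂ) ≠ 0 := by exact_mod_cast hmass
  have hS : ∏ k : Fin m, krylov α k.castSucc k.castSucc ^ 2 ≠ 0 :=
    Finset.prod_ne_zero_iff.2 fun k _ => pow_ne_zero 2 (hc.krylov_ne_zero _)
  have hT : krylov α (Fin.last m) (Fin.last m) ^ 2 ≠ 0 := pow_ne_zero 2 (hc.krylov_ne_zero _)
  have hlastne : star (α (Fin.last m)) ≠ 0 := by
    rw [star_ne_zero, hα, verblunsky_last]; exact Complex.exp_ne_zero _
  have hsign : ((-1 : ℂ) ^ m) * (-1) ^ m = 1 := by rw [← mul_pow]; simp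
  have hI : Complex.I ^ m ≠ 0 := pow_ne_zero _ Complex.I_ne_zero
  rw [hz] at hmul
  generalize (∏ k : Fin m, krylov α k.castSucc k.castSucc ^ 2) = S at *
  generalize hTdef : krylov α (Fin.last m) (Fin.last m) ^ 2 = T at *
  generalize star (α (Fin.last m)) = a at *
  -- With W = |Δ|, `hprod` reads S T = (∏μ) W². Cancelling the phases and S² T from the determinant
  -- identity leaves this relation, in which W no longer occurs.
  have key : (δ : ℂ) * 2 ^ m * ∏ j, (mass x j : ℂ) = -T := by
    have hne : Complex.I ^ m * Complex.I * a * S ^ 2 * T ≠ 0 :=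
      mul_ne_zero (mul_ne_zero (mul_ne_zero (mul_ne_zero hI Complex.I_ne_zero) hlastne)
        (pow_ne_zero 2 hS)) hT
    apply mul_left_cancel₀ hne
    rw [mul_pow, pow_succ] at hmul
    generalize ((‖(vandermonde (point x)).det‖ : ℂ)) = W at *
    linear_combination (∏ j, (mass x j : ℂ)) * hmul -
      Complex.I ^ m * Complex.I * a * ((∏ j, (mass x j : ℂ)) * W ^ 2) ^ 2 * hsign +
      Complex.I ^ m * Complex.I * a * (S * T + (∏ j, (mass x j : ℂ)) * W ^ 2) * hprod
  rw [hlast] at key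
  have keyR : δ * 2 ^ m * ∏ j, mass x j = -∏ k : Fin m, rho (α k.castSucc) ^ 2 := by
    exact_mod_cast key
  have h2 : (2 : ℝ) ^ (1 - ((m + 1 : ℕ) : ℤ)) = (2 ^ m)⁻¹ := by
    rw [← zpow_natCast, ← _root_.zpow_neg]; congr 1; push_cast; ring
  rw [h2]
  field_simp
  linarith

end CMV

end

theorem mainTheorem11 (m : ℕ) :
    (∃ F : CMV.Coord m → CMV.Coord m, CMV.IsChangeOfVariables (CMV.specDomain m) F) ∧
    ∀ (U : Set (CMV.Coord m)) (F : CMV.Coord m → CMV.Coord m),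
      IsOpen U → U ⊆ CMV.specDomain m → CMV.IsChangeOfVariables U F →
      ∀ x ∈ U, DifferentiableAt ℝ F x ∧
        (fderiv ℝ F x).det =
          -((2 : ℝ) ^ (1 - ((m + 1 : ℕ) : ℤ)) *
            ((∏ k : Fin m, CMV.rho (CMV.verblunsky (F x) k.castSucc) ^ 2) /
              ∏ j : Fin (m + 1), CMV.mass x j)) := by
  refine ⟨CMV.exists_isChangeOfVariables m, fun U F hU hUs hF x hx => ⟨?_, ?_⟩⟩
  · exact CMV.differentiableAt_of_isChangeOfVariables hU hF hx
  · exact CMV.det_fderiv_changeOfVariables hU hUs hF hx
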